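/- Let $T>0$, $n,m\ge 0$ integers, $U\subset\mathbb R^m$ bounded, closed and convex, $C\subset\mathbb R^{n}\times\mathbb R^n$ compact, and let $F:[0,T]\times\mathbb R^n\rightrightarrows\mathbb R^n$, $g:[0,T]\times[0,T]\times\mathbb R^n\times\mathbb R^m\to\mathbb R^n$, $\ell:\mathbb R^n\times\mathbb R^n\to\overline{\mathbb R}$, $\varphi:[0,T]\times\mathbb R^n\times\mathbb R^n\times\mathbb R^m\to\overline{\mathbb R}$. "Measurable" means Lebesgue measurable. Put $D=\{(t,s)\in[0,T]^2: s\le t\}$. A *control* is a measurable $u:[0,T]\to\mathbb R^m$ with $u(t)\in U$ for a.e. $t$, and $$\mathcal G(x,u)(t)=\int_0^t g(t,s,x(s),u(s))\,ds .$$ A pair $(x,u)$ is *feasible* if $x:[0,T]\to\mathbb R^n$ is absolutely continuous, $u$ is a control, $(x(0),x(T))\in C$, and $$\dot x(t)\in F(t,x(t))+\int_0^t g(t,s,x(s),u(s))\,ds\quad\text{for a.e. }t\in[0,T].$$ Consider the problem of minimizing $$J(x,u)=\ell(x(0),x(T))+\int_0^T\varphi(s,x(s),\dot x(s),u(s))\,ds$$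 over all feasible pairs (if $\ell=-\infty$ and the integral is $+\infty$, the sum is taken to be $-\infty$). Assume: * $F$ has nonempty, closed and convex values; for each $v\in\mathbb R^n$ the map $F(\cdot,v)$ is measurable (that is, $\{t\in[0,T]: F(t,v)\cap O\neq\emptyset\}$ is measurable for every open $O$); for a.e. $t$ the map $F(t,\cdot)$ is upper semicontinuous; and there are nonnegative integrable $c,d$ on $[0,T]$ such that, for a.e. $t$, $\|w\|\le c(t)\|x\|+d(t)$ for all $x\in\mathbb R^n$ and all $w\in F(t,x)$. * (i) For every $u\in U$: for each $x$, the map $(t,s)\mapsto g(t,s,x,u)$ is measurable on $[0,T]^2$; for each $r>0$ there is an integrable $\mu_r:[0,T]\to[0,\infty)$ with $\|g(t,s,x,u)-g(t,s,y,u)\|\le\mu_r(t)\|x-y\|$ for all $(t,s)\in D$ and $\|x\|,\|y\|\le r$; and there is an integrable $\sigma:D\to[0,\infty)$ with $\|g(t,s,x,u)\|\le\sigma(t,s)(1+\|x\|)$ for all $(t,s)\in D$ and $x\in\mathbb R^n$. (The functions $\mu_r$ and $\sigma$ may depend on $u$.) * (ii) The integral mapping is well defined and norm-weak continuous: for every continuous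 $x:[0,T]\to\mathbb R^n$, every control $u$ and every $t\in[0,T]$, the function $s\mapsto g(t,s,x(s),u(s))$ is integrable on $[0,t]$; and $\mathcal G(x_k,u_k)(t)\to\mathcal G(x,u)(t)$ for all $t\in[0,T]$ whenever $x_k\to x$ in $C([0,T];\mathbb R^n)$ and $u_k\rightharpoonup u$ weakly in $L^2([0,T];\mathbb R^m)$, where $u_k$ and $u$ are controls. * (iii) $\ell$ is lower semicontinuous. * (iv) $\varphi$ is a normal integrand, i.e. $t\mapsto\operatorname{epi}\varphi(t,\cdot,\cdot,\cdot)$ is a measurable set-valued map with closed values; $\varphi(s,x,\cdot,\cdot)$ is convex for all $(s,x)\in[0,T]\times\mathbb R^n$; and there is $\eta\in L^1([0,T];\mathbb R)$ with $\varphi(s,x,y,u)\ge\eta(s)$ for all $s\in[0,T]$, $x,y\in\mathbb R^n$, $u\in U$. (No convexity of $g$ is assumed.) If the value $\inf J$ over feasible pairs is finite (a real number), then there is a feasible pair $(x,u)$ at which this infimum is attained. -/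

import Mathlib

open Set Filter Topology MeasureTheory

noncomputable section

namespace IntegroDiff

/-- The Euclidean space `ℝⁿ`. -/
abbrev Vec (n : ℕ) : Type := EuclideanSpace ℝ (Fin n)

/-- Lebesgue measure on `[0,T]`. -/
abbrev timeMeasure (T : ℝ) : Measure ℝ := volume.restrict (Icc 0 T)

/-- The triangle `D = {(t,s) ∈ [0,T] × [0,T] : s ≤ t}`. -/
def triangle (T : ℝ) : Set (ℝ × ℝ) :=
  {p | p.1 ∈ Icc 0 T ∧ p.2 ∈ Icc 0 T ∧ p.2 ≤ p.1}

/-- Measurability of a set-valued map on `[0,T]`: the preimage `{t ∈ [0,T] : S(t) ∩ O ≠ ∅}` of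
every open set `O` is Lebesgue measurable. -/
def MeasurableMultimap {X : Type*} [TopologicalSpace X] (T : ℝ) (S : ℝ → Set X) : Prop :=
  ∀ O : Set X, IsOpen O → NullMeasurableSet {t | t ∈ Icc 0 T ∧ (S t ∩ O).Nonempty} volume

/-- The epigraph of an extended-real-valued function. -/
def epigraph {X : Type*} (f : X → EReal) : Set (X × ℝ) := {p | f p.1 ≤ (p.2 : EReal)}

/-- Normal integrands on `[0,T] × X`: the epigraphical mapping `t ↦ epi f(t,·)` is closed-valued
and measurable. -/
def NormalIntegrand {X : Type*} [TopologicalSpace X] (T : ℝ) (f : ℝ → X → EReal) : Prop :=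
  (∀ t ∈ Icc 0 T, IsClosed (epigraph (f t))) ∧ MeasurableMultimap T (fun t => epigraph (f t))

/-- Convexity of an extended-real-valued function, through its epigraph. -/
def ConvexEReal {X : Type*} [AddCommGroup X] [Module ℝ X] (f : X → EReal) : Prop :=
  Convex ℝ (epigraph f)

/-- The integral over `[0,T]` of an extended-real-valued function: the integral of the positive
part minus that of the negative part. (It is used only for functions whose negative part has a
finite integral, so no `∞ - ∞` occurs; the value may be `+∞`.) -/
def integralEReal (T : ℝ) (f : ℝ → EReal) : EReal :=
  ((∫⁻ t in Icc 0 T, (f t).toENNReal : ENNReal) : EReal) -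
    ((∫⁻ t in Icc 0 T, (-f t).toENNReal : ENNReal) : EReal)

/-- `x ∈ AC([0,T]; ℝⁿ)`: `x` is on `[0,T]` the indefinite integral of an integrable function. -/
def IsAC {n : ℕ} (T : ℝ) (x : ℝ → Vec n) : Prop :=
  ∃ (x₀ : Vec n) (f : ℝ → Vec n), IntegrableOn f (Icc 0 T) ∧
    ∀ t ∈ Icc 0 T, x t = x₀ + ∫ s in (0 : ℝ)..t, f s

/-- Hypotheses on the set-valued map `F`: nonempty closed convex values, measurability in time,
upper semicontinuity in the state for almost every time, and linear growth of *all* elements of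
`F(t,x)`. (In finite dimensions the weak and the norm topology coincide.) -/
structure HypF {n : ℕ} (T : ℝ) (F : ℝ → Vec n → Set (Vec n)) : Prop where
  nonempty : ∀ t ∈ Icc 0 T, ∀ x, (F t x).Nonempty
  closed : ∀ t ∈ Icc 0 T, ∀ x, IsClosed (F t x)
  convex : ∀ t ∈ Icc 0 T, ∀ x, Convex ℝ (F t x)
  measurable : ∀ x, MeasurableMultimap T (fun t => F t x)
  usc : ∀ᵐ t ∂(timeMeasure T), UpperHemicontinuous (F t)
  growth : ∃ c d : ℝ → ℝ, (∀ t ∈ Icc 0 T, 0 ≤ c t) ∧ (∀ t ∈ Icc 0 T, 0 ≤ d t) ∧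
    IntegrableOn c (Icc 0 T) ∧ IntegrableOn d (Icc 0 T) ∧
    ∀ᵐ t ∂(timeMeasure T), ∀ x, ∀ w ∈ F t x, ‖w‖ ≤ c t * ‖x‖ + d t

/-- Hypotheses on a kernel `h(t,s,x)`: Lebesgue measurable in `(t,s)`, Lipschitz on balls in `x`,
and of linear growth in `x`. -/
structure HypKernel {n : ℕ} (T : ℝ) (h : ℝ → ℝ → Vec n → Vec n) : Prop where
  measurable : ∀ x, AEMeasurable (fun p : ℝ × ℝ => h p.1 p.2 x)
    (volume.restrict (Icc 0 T ×ˢ Icc 0 T))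
  lipschitz : ∀ r : ℝ, 0 < r → ∃ μ : ℝ → ℝ, (∀ t ∈ Icc 0 T, 0 ≤ μ t) ∧
    IntegrableOn μ (Icc 0 T) ∧
    ∀ t s, (t, s) ∈ triangle T → ∀ x y : Vec n, ‖x‖ ≤ r → ‖y‖ ≤ r →
      ‖h t s x - h t s y‖ ≤ μ t * ‖x - y‖
  growth : ∃ σ : ℝ × ℝ → ℝ, (∀ p ∈ triangle T, 0 ≤ σ p) ∧ IntegrableOn σ (triangle T) ∧
    ∀ t s, (t, s) ∈ triangle T → ∀ x : Vec n, ‖h t s x‖ ≤ σ (t, s) * (1 + ‖x‖)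

/-- Controls: measurable functions `u` with `u(t) ∈ U` for almost every `t ∈ [0,T]`. -/
def IsControl {m : ℕ} (T : ℝ) (U : Set (Vec m)) (u : ℝ → Vec m) : Prop :=
  AEMeasurable u (timeMeasure T) ∧ ∀ᵐ t ∂(timeMeasure T), u t ∈ U

/-- The integral mapping `𝒢(x,u)(t) = ∫₀ᵗ g(t,s,x(s),u(s)) ds`. -/
def integralMap {n m : ℕ} (g : ℝ → ℝ → Vec n → Vec m → Vec n) (x : ℝ → Vec n) (u : ℝ → Vec m)
    (t : ℝ) : Vec n :=
  ∫ s in (0 : ℝ)..t, g t s (x s) (u s)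

/-- Weak convergence `uₖ ⇀ u` in `L²([0,T]; ℝᵐ)`, tested against all `ψ ∈ L²([0,T]; ℝᵐ)`. -/
def WeakL2Tendsto {m : ℕ} (T : ℝ) (uk : ℕ → ℝ → Vec m) (u : ℝ → Vec m) : Prop :=
  (∀ k, MemLp (uk k) 2 (timeMeasure T)) ∧ MemLp u 2 (timeMeasure T) ∧
    ∀ ψ : ℝ → Vec m, MemLp ψ 2 (timeMeasure T) →
      Tendsto (fun k => ∫ t in Icc 0 T, inner ℝ (uk k t) (ψ t)) atTop
        (𝓝 (∫ t in Icc 0 T, inner ℝ (u t) (ψ t)))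

/-- The integral mapping is well defined, and norm-weak continuous: `𝒢(xₖ,uₖ)(t) → 𝒢(x,u)(t)` for
every `t ∈ [0,T]` whenever `xₖ → x` in `C([0,T]; ℝⁿ)` and the controls `uₖ` converge weakly in
`L²([0,T]; ℝᵐ)` to the control `u`. -/
structure NormWeakContinuous {n m : ℕ} (T : ℝ) (U : Set (Vec m))
    (g : ℝ → ℝ → Vec n → Vec m → Vec n) : Prop where
  integrable : ∀ (x : ℝ → Vec n) (u : ℝ → Vec m), ContinuousOn x (Icc 0 T) → IsControl T U u →
    ∀ t ∈ Icc 0 T, IntervalIntegrable (fun s => g t s (x s) (u s)) volume 0 t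
  tendsto : ∀ (xk : ℕ → ℝ → Vec n) (x : ℝ → Vec n) (uk : ℕ → ℝ → Vec m) (u : ℝ → Vec m),
    (∀ k, ContinuousOn (xk k) (Icc 0 T)) → ContinuousOn x (Icc 0 T) →
    TendstoUniformlyOn xk x atTop (Icc 0 T) →
    (∀ k, IsControl T U (uk k)) → IsControl T U u → WeakL2Tendsto T uk u →
    ∀ t ∈ Icc 0 T,
      Tendsto (fun k => integralMap g (xk k) (uk k) t) atTop (𝓝 (integralMap g x u t))

/-- Feasible pairs `(x,u)`: `x` is absolutely continuous, `u` is a control,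
`ẋ(t) ∈ F(t,x(t)) + ∫₀ᵗ g(t,s,x(s),u(s)) ds` for almost every `t`, and `(x(0),x(T)) ∈ C`. -/
structure Feasible {n m : ℕ} (T : ℝ) (F : ℝ → Vec n → Set (Vec n))
    (g : ℝ → ℝ → Vec n → Vec m → Vec n) (U : Set (Vec m)) (C : Set (Vec n × Vec n))
    (x : ℝ → Vec n) (u : ℝ → Vec m) : Prop where
  ac : IsAC T x
  control : IsControl T U u
  inclusion : ∀ᵐ t ∂(timeMeasure T), ∃ w ∈ F t (x t), deriv x t = w + integralMap g x u t
  endpoints : (x 0, x T) ∈ C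

/-- The cost `ℓ(x(0),x(T)) + ∫₀ᵀ φ(s,x(s),ẋ(s),u(s)) ds`. In `EReal`, `(-∞) + (+∞) = -∞`. -/
def cost {n m : ℕ} (T : ℝ) (l : Vec n × Vec n → EReal)
    (φ : ℝ → Vec n × Vec n × Vec m → EReal) (x : ℝ → Vec n) (u : ℝ → Vec m) : EReal :=
  l (x 0, x T) + integralEReal T (fun s => φ s (x s, deriv x s, u s))

/-- The value of the problem: the infimum of the cost over all feasible pairs (`+∞` if none). -/
def value {n m : ℕ} (T : ℝ) (F : ℝ → Vec n → Set (Vec n))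
    (g : ℝ → ℝ → Vec n → Vec m → Vec n) (U : Set (Vec m)) (C : Set (Vec n × Vec n))
    (l : Vec n × Vec n → EReal) (φ : ℝ → Vec n × Vec n × Vec m → EReal) : EReal :=
  sInf {J | ∃ x u, Feasible T F g U C x u ∧ J = cost T l φ x u}

end IntegroDiff

end

/-! The proof is the direct method. The first obstacle is an a priori bound: the growth majorant of
`g` depends on the control value, so no majorant uniform in the control is given. It is extracted
from norm-weak continuity. Controls switching ever faster between `u` and `v` converge weakly to
their midpoint, while any integrand evaluated along them averages in the limit to the mean of its
values at `u` and at `v`. Hence the integral mapping is midpoint-affine, and by continuity affine,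
in the control, although `g` itself is arbitrary (`integralMap_midpoint`, `integralMap_combo`).
Restricted to constant control values on a measurable set of times, this gives affine maps on `U`,
which are controlled by their values at finitely many points of `U`
(`exists_finset_norm_le_of_affine`). Finitely many majorants then suffice, and
`exists_integralMap_bound` follows through simple controls. A Gronwall argument bounds all
trajectories and dominates their derivatives by one integrable function (`exists_apriori_bound`).

A minimizing sequence therefore has a subsequence whose trajectories converge uniformly and whose
controls converge weakly; Mazur's lemma makes convex combinations of derivatives and controls, with
common weights, converge almost everywhere (`exists_limit_pair`). Convexity and upper semicontinuity
carry the inclusion to the limit (`mem_of_tailWeights_of_upperHemicontinuous`). For the cost, affine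
minorants of the integrand survive averaging, and Fatou's lemma gives lower semicontinuity of the
integral (`le_liminf_sum_of_tailWeights`, `integralEReal_le_of_eventually_le`). -/

noncomputable section

namespace IntegroDiff

/-! ### Convex combinations of tails and weak compactness. -/

/-- Weights of convex combinations of the tails of a sequence. -/
def IsTailWeights (W : ℕ → Finset ℕ) (w : ℕ → ℕ → ℝ) : Prop :=
  ∀ N, (∀ k ∈ W N, N ≤ k ∧ 0 ≤ w N k) ∧ ∑ k ∈ W N, w N k = 1

theorem IsTailWeights.comp {W : ℕ → Finset ℕ} {w : ℕ → ℕ → ℝ} (h : IsTailWeights W w)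
    {ns : ℕ → ℕ} (hns : StrictMono ns) : IsTailWeights (W ∘ ns) (w ∘ ns) := fun N =>
  ⟨fun k hk => ⟨(hns.le_apply).trans ((h (ns N)).1 k hk).1, ((h (ns N)).1 k hk).2⟩, (h (ns N)).2⟩

theorem IsTailWeights.eventually_forall {W : ℕ → Finset ℕ} {w : ℕ → ℕ → ℝ}
    (h : IsTailWeights W w) {p : ℕ → Prop} (hp : ∀ᶠ k in atTop, p k) :
    ∀ᶠ N in atTop, ∀ k ∈ W N, p k := by
  obtain ⟨K, hK⟩ := eventually_atTop.1 hp
  filter_upwards [eventually_ge_atTop K] with N hN k hk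
  exact hK k (hN.trans ((h N).1 k hk).1)

theorem IsTailWeights.sum_mem {W : ℕ → Finset ℕ} {w : ℕ → ℕ → ℝ} (h : IsTailWeights W w)
    {E : Type*} [AddCommGroup E] [Module ℝ E] {S : Set E} (hS : Convex ℝ S) {a : ℕ → E} {N : ℕ}
    (ha : ∀ k ∈ W N, a k ∈ S) : ∑ k ∈ W N, w N k • a k ∈ S :=
  hS.sum_mem (fun k hk => ((h N).1 k hk).2) (h N).2 ha

theorem IsTailWeights.tendsto {W : ℕ → Finset ℕ} {w : ℕ → ℕ → ℝ} (h : IsTailWeights W w)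
    {E : Type*} [NormedAddCommGroup E] [NormedSpace ℝ E] {a : ℕ → E} {b : E}
    (ha : Tendsto a atTop (𝓝 b)) :
    Tendsto (fun N => ∑ k ∈ W N, w N k • a k) atTop (𝓝 b) := by
  rw [Metric.tendsto_nhds]
  intro ε hε
  filter_upwards [h.eventually_forall (Metric.tendsto_nhds.1 ha ε hε)] with N hN
  exact h.sum_mem (convex_ball b ε) hN

/-- Mazur's lemma for sequences. -/
theorem exists_tailWeights_of_weak_tendsto {E : Type*} [NormedAddCommGroup E] [NormedSpace ℝ E]
    {z : ℕ → E} {z₀ : E}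
    (hz : ∀ f : E →L[ℝ] ℝ, Tendsto (fun k => f (z k)) atTop (𝓝 (f z₀))) :
    ∃ W w, IsTailWeights W w ∧ Tendsto (fun N => ∑ k ∈ W N, w N k • z k) atTop (𝓝 z₀) := by
  have key : ∀ N : ℕ, ∃ (s : Finset ℕ) (w : ℕ → ℝ), ((∀ k ∈ s, N ≤ k ∧ 0 ≤ w k) ∧
      ∑ k ∈ s, w k = 1) ∧ dist (∑ k ∈ s, w k • z k) z₀ < 1 / ((N : ℝ) + 1) := by
    intro N
    let A : Set E := {y | ∃ (s : Finset ℕ) (w : ℕ → ℝ), ((∀ k ∈ s, N ≤ k ∧ 0 ≤ w k) ∧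
      ∑ k ∈ s, w k = 1) ∧ ∑ k ∈ s, w k • z k = y}
    have hA : Convex ℝ A := by
      rintro _ ⟨s, w, ⟨hs, hs1⟩, rfl⟩ _ ⟨s', w', ⟨hs', hs1'⟩, rfl⟩ a b ha hb hab
      classical
      let v : ℕ → ℝ := fun k => a * (if k ∈ s then w k else 0) + b * (if k ∈ s' then w' k else 0)
      refine ⟨s ∪ s', v, ⟨fun k hk => ⟨?_, ?_⟩, ?_⟩, ?_⟩
      · rcases Finset.mem_union.1 hk with h | h
        exacts [(hs k h).1, (hs' k h).1]
      · refine add_nonneg (mul_nonneg ha ?_) (mul_nonneg hb ?_)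
        · split_ifs with h
          exacts [(hs k h).2, le_rfl]
        · split_ifs with h
          exacts [(hs' k h).2, le_rfl]
      · simp only [v, Finset.sum_add_distrib, ← Finset.mul_sum, Finset.sum_ite_mem,
          Finset.union_inter_cancel_left, Finset.union_inter_cancel_right, hs1, hs1', mul_one, hab]
      · simp only [v, add_smul, mul_smul, Finset.sum_add_distrib, ← Finset.smul_sum, ite_smul,
          zero_smul, Finset.sum_ite_mem, Finset.union_inter_cancel_left,
          Finset.union_inter_cancel_right]
    have hzA : ∀ k, N ≤ k → z k ∈ A := fun k hk => ⟨{k}, fun _ => 1, by simpa using hk, by simp⟩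
    have hmem : z₀ ∈ closure A := by
      by_contra hcon
      -- A separating functional stays below `u` on the whole tail and exceeds `u` at `z₀`, against
      -- weak convergence.
      obtain ⟨f, u, hfu, huf⟩ := geometric_hahn_banach_closed_point hA.closure isClosed_closure hcon
      have : f z₀ ≤ u := le_of_tendsto (hz f) (by
        filter_upwards [eventually_ge_atTop N] with k hk
        exact (hfu _ (subset_closure (hzA k hk))).le)
      linarith
    obtain ⟨y, ⟨s, w, h, rfl⟩, hy⟩ := Metric.mem_closure_iff.1 hmem (1 / ((N : ℝ) + 1)) (by positivity)
    exact ⟨s, w, h, by rwa [dist_comm]⟩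
  choose W w hW hd using key
  refine ⟨W, w, hW, ?_⟩
  rw [tendsto_iff_dist_tendsto_zero]
  exact squeeze_zero (fun _ => dist_nonneg) (fun N => (hd N).le) tendsto_one_div_add_atTop_nhds_zero_nat

/-- Bounded sequences of a separable Hilbert space have weakly convergent subsequences. -/
theorem exists_subseq_weak_tendsto {H : Type*} [NormedAddCommGroup H] [InnerProductSpace ℝ H]
    [CompleteSpace H] [TopologicalSpace.SeparableSpace H] {z : ℕ → H} {R : ℝ}
    (hz : ∀ k, ‖z k‖ ≤ R) :
    ∃ (z₀ : H) (ns : ℕ → ℕ), StrictMono ns ∧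
      ∀ h, Tendsto (fun k => inner ℝ (z (ns k)) h) atTop (𝓝 (inner ℝ z₀ h)) := by
  let y : ℕ → WeakDual ℝ H := fun k =>
    StrongDual.toWeakDual (InnerProductSpace.toDual ℝ H (z k))
  have hy : ∀ k, y k ∈ WeakDual.toStrongDual ⁻¹' Metric.closedBall (0 : StrongDual ℝ H) R := by
    intro k
    have : WeakDual.toStrongDual (y k) = InnerProductSpace.toDual ℝ H (z k) := rfl
    rw [mem_preimage, this, mem_closedBall_zero_iff, LinearIsometryEquiv.norm_map]
    exact hz k
  obtain ⟨y₀, -, ns, hns, hlim⟩ := WeakDual.isSeqCompact_closedBall ℝ H 0 R hy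
  refine ⟨(InnerProductSpace.toDual ℝ H).symm (WeakDual.toStrongDual y₀), ns, hns, fun h => ?_⟩
  have h1 := ((WeakDual.eval_continuous h).tendsto y₀).comp hlim
  have h2 : inner ℝ ((InnerProductSpace.toDual ℝ H).symm (WeakDual.toStrongDual y₀)) h = y₀ h := by
    rw [InnerProductSpace.toDual_symm_apply]; rfl
  rw [h2]
  exact h1

/-! ### Rapidly switching controls. -/

/-- The square wave `s ↦ (-1)^⌊r s⌋`. -/
def squareWave (r s : ℝ) : ℝ := if Even ⌊r * s⌋ then 1 else -1

theorem squareWave_eq (r s : ℝ) : squareWave r s = 1 ∨ squareWave r s = -1 := by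
  unfold squareWave; split_ifs <;> simp

theorem abs_squareWave (r s : ℝ) : |squareWave r s| = 1 := by
  rcases squareWave_eq r s with h | h <;> simp [h]

theorem measurable_squareWave (r : ℝ) : Measurable (squareWave r) := by
  have h : Measurable fun s : ℝ => ⌊r * s⌋ := Int.measurable_floor.comp (measurable_const_mul r)
  exact Measurable.ite (h (MeasurableSet.of_discrete (s := {i : ℤ | Even i}))) measurable_const measurable_const

theorem squareWave_add {r : ℝ} (hr : r ≠ 0) (s : ℝ) : squareWave r (s + 1 / r) = -squareWave r s := by
  have h : r * (s + 1 / r) = r * s + 1 := by field_simp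
  have h' : Even ⌊r * (s + 1 / r)⌋ ↔ ¬Even ⌊r * s⌋ := by
    rw [h, Int.floor_add_one, Int.even_add_one]
  unfold squareWave
  by_cases hp : Even ⌊r * s⌋
  · rw [if_pos hp, if_neg (by tauto)]
  · rw [if_neg hp, if_pos (by tauto), neg_neg]

theorem tendsto_integral_norm_sub_translate {E : Type*} [NormedAddCommGroup E] {f : ℝ → E}
    (hf : Integrable f) : Tendsto (fun h : ℝ => ∫ s, ‖f (s + h) - f s‖) (𝓝 0) (𝓝 0) := by
  let F : Lp E 1 (volume : Measure ℝ) := hf.toL1 f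
  let τ : ℝ → C(ℝ, ℝ) := fun h => ⟨fun s => s + h, by fun_prop⟩
  have hτ : ∀ h, MeasurePreserving (τ h) volume volume := fun h =>
    measurePreserving_add_right volume h
  have hτc : Continuous τ := ContinuousMap.continuous_of_continuous_uncurry _ (by
    change Continuous fun p : ℝ × ℝ => p.2 + p.1
    fun_prop)
  have hcont := (continuous_const (y := F)).compMeasurePreservingLp hτc hτ (by norm_num)
  have hFf : F =ᵐ[volume] f := hf.coeFn_toL1
  have h0 : Lp.compMeasurePreserving (τ 0) (hτ 0) F = F := by
    refine Lp.ext ((Lp.coeFn_compMeasurePreserving F (hτ 0)).trans (ae_of_all _ fun s => ?_))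
    simp [τ]
  have hlim := (hcont.tendsto 0)
  rw [tendsto_iff_dist_tendsto_zero] at hlim
  refine hlim.congr fun h => ?_
  rw [h0, L1.dist_eq_integral_dist]
  refine integral_congr_ae ?_
  filter_upwards [Lp.coeFn_compMeasurePreserving F (hτ h), hFf,
    (hτ h).quasiMeasurePreserving.ae hFf] with s h1 h2 h3
  rw [h1, h2, dist_eq_norm, Function.comp_apply, h3]
  rfl

/-- Translation by the half period `1 / r` flips the sign of the wave, so twice the integral is at
most the L¹ distance between `f` and its translate, which vanishes by continuity of translations. -/
theorem tendsto_integral_squareWave_smul {E : Type*} [NormedAddCommGroup E] [NormedSpace ℝ E]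
    {f : ℝ → E} (hf : Integrable f) :
    Tendsto (fun k : ℕ => ∫ s, squareWave ((k : ℝ) + 1) s • f s) atTop (𝓝 0) := by
  have hint : ∀ (r : ℝ) {f : ℝ → E}, Integrable f → Integrable fun s => squareWave r s • f s :=
    fun r f hf => hf.bdd_smul 1 (measurable_squareWave r).aestronglyMeasurable
      (ae_of_all _ fun s => by rw [Real.norm_eq_abs, abs_squareWave])
  have hlim : Tendsto (fun k : ℕ => ∫ s, ‖f (s + 1 / ((k : ℝ) + 1)) - f s‖) atTop (𝓝 0) :=
    (tendsto_integral_norm_sub_translate hf).comp tendsto_one_div_add_atTop_nhds_zero_nat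
  refine squeeze_zero_norm (fun k => ?_) hlim
  set r : ℝ := (k : ℝ) + 1
  have hr : r ≠ 0 := by positivity
  have hft : Integrable fun s => f (s + 1 / r) := hf.comp_add_right _
  have h1 : ∫ s, squareWave r s • f s = -∫ s, squareWave r s • f (s + 1 / r) := by
    rw [← integral_add_right_eq_self (μ := volume) (fun s => squareWave r s • f s) (1 / r),
      ← integral_neg]
    exact integral_congr_ae (ae_of_all _ fun s => by
      simp only [squareWave_add hr, neg_smul])
  have h2 : (2 : ℝ) • ∫ s, squareWave r s • f s = -∫ s, squareWave r s • (f (s + 1 / r) - f s) := by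
    simp only [smul_sub]
    rw [integral_sub (hint r hft) (hint r hf), two_smul]
    nth_rewrite 1 [h1]
    abel
  have h3 : 2 * ‖∫ s, squareWave r s • f s‖ ≤ ∫ s, ‖f (s + 1 / r) - f s‖ := by
    have := congrArg norm h2
    rw [norm_smul, norm_neg, Real.norm_of_nonneg (by norm_num : (0 : ℝ) ≤ 2)] at this
    rw [this]
    refine (norm_integral_le_integral_norm _).trans_eq (integral_congr_ae (ae_of_all _ fun s => ?_))
    simp [norm_smul, abs_squareWave]
  linarith [norm_nonneg (∫ s, squareWave r s • f s)]

theorem tendsto_setIntegral_squareWave_smul {E : Type*} [NormedAddCommGroup E] [NormedSpace ℝ E]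
    {f : ℝ → E} {S : Set ℝ} (hS : MeasurableSet S) (hf : IntegrableOn f S) :
    Tendsto (fun k : ℕ => ∫ s in S, squareWave ((k : ℝ) + 1) s • f s) atTop (𝓝 0) := by
  refine (tendsto_integral_squareWave_smul ((integrable_indicator_iff hS).2 hf)).congr fun k => ?_
  rw [← integral_indicator hS]
  refine integral_congr_ae (ae_of_all _ fun s => ?_)
  by_cases hs : s ∈ S <;> simp [hs]

/-- Controls between which the square wave switches. -/
def switch {m : ℕ} (u v : ℝ → Vec m) (k : ℕ) (s : ℝ) : Vec m :=
  if squareWave ((k : ℝ) + 1) s = 1 then u s else v s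

/-- Mean plus or minus half the difference: no linearity of `f` is needed, and the square wave is
the only factor that depends on `k`. -/
theorem comp_switch {m : ℕ} {V : Type*} [AddCommGroup V] [Module ℝ V] (u v : ℝ → Vec m) (k : ℕ)
    (s : ℝ) (f : Vec m → V) :
    f (switch u v k s) = ((1 / 2 : ℝ) • f (u s) + (1 / 2 : ℝ) • f (v s)) +
      squareWave ((k : ℝ) + 1) s • ((1 / 2 : ℝ) • (f (u s) - f (v s))) := by
  unfold switch
  rcases squareWave_eq ((k : ℝ) + 1) s with h | h
  · rw [if_pos h, h]; module
  · rw [if_neg (by rw [h]; norm_num), h]; module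

section Controls

variable {m : ℕ} {T : ℝ} {U : Set (Vec m)}

theorem IsControl.memLp {u : ℝ → Vec m} (hU : Bornology.IsBounded U) (hu : IsControl T U u)
    (p : ENNReal) : MemLp u p (timeMeasure T) := by
  obtain ⟨R, hR⟩ := hU.exists_norm_le
  exact MemLp.of_bound hu.1.aestronglyMeasurable R (hu.2.mono fun t ht => hR _ ht)

theorem IsControl.switch {u v : ℝ → Vec m} (hu : IsControl T U u) (hv : IsControl T U v) (k : ℕ) :
    IsControl T U (switch u v k) := by
  constructor
  · have hs : MeasurableSet {s | squareWave ((k : ℝ) + 1) s = 1} :=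
      measurable_squareWave _ (measurableSet_singleton 1)
    refine ⟨fun s => if squareWave ((k : ℝ) + 1) s = 1 then hu.1.mk u s else hv.1.mk v s,
      Measurable.ite hs hu.1.measurable_mk hv.1.measurable_mk, ?_⟩
    filter_upwards [hu.1.ae_eq_mk, hv.1.ae_eq_mk] with s h1 h2
    unfold IntegroDiff.switch
    rw [← h1, ← h2]
  · filter_upwards [hu.2, hv.2] with t h1 h2
    unfold IntegroDiff.switch
    split_ifs
    exacts [h1, h2]

theorem IsControl.combo {u v : ℝ → Vec m} (hU : Convex ℝ U) (hu : IsControl T U u)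
    (hv : IsControl T U v) {a b : ℝ} (ha : 0 ≤ a) (hb : 0 ≤ b) (hab : a + b = 1) :
    IsControl T U (fun s => a • u s + b • v s) := by
  refine ⟨(hu.1.const_smul a).add (hv.1.const_smul b), ?_⟩
  filter_upwards [hu.2, hv.2] with t h1 h2 using hU h1 h2 ha hb hab

theorem integrable_inner_of_memLp_two {α E : Type*} [MeasurableSpace α] {μ : Measure α}
    [NormedAddCommGroup E] [InnerProductSpace ℝ E] {u v : α → E} (hu : MemLp u 2 μ)
    (hv : MemLp v 2 μ) : Integrable (fun t => inner ℝ (u t) (v t)) μ := by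
  refine (L2.integrable_inner (𝕜 := ℝ) (hu.toLp u) (hv.toLp v)).congr ?_
  filter_upwards [hu.coeFn_toLp, hv.coeFn_toLp] with t h1 h2
  rw [h1, h2]

theorem weakL2Tendsto_switch {u v : ℝ → Vec m} (hU : Bornology.IsBounded U) (hUc : Convex ℝ U)
    (hu : IsControl T U u) (hv : IsControl T U v) :
    WeakL2Tendsto T (switch u v) (fun s => (1 / 2 : ℝ) • u s + (1 / 2 : ℝ) • v s) := by
  have hmid := hu.combo hUc hv (a := 1 / 2) (b := 1 / 2) (by norm_num) (by norm_num) (by norm_num)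
  refine ⟨fun k => (hu.switch hv k).memLp hU 2, hmid.memLp hU 2, fun ψ hψ => ?_⟩
  have h1 : Integrable (fun t => inner ℝ ((1 / 2 : ℝ) • u t + (1 / 2 : ℝ) • v t) (ψ t))
      (timeMeasure T) := integrable_inner_of_memLp_two (hmid.memLp hU 2) hψ
  have h2 : Integrable (fun t => (1 / 2 : ℝ) • (inner ℝ (u t) (ψ t) - inner ℝ (v t) (ψ t)))
      (timeMeasure T) :=
    ((integrable_inner_of_memLp_two (hu.memLp hU 2) hψ).sub
      (integrable_inner_of_memLp_two (hv.memLp hU 2) hψ)).smul (1 / 2 : ℝ)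
  have h3 := (tendsto_setIntegral_squareWave_smul measurableSet_Icc h2).const_add
    (∫ t in Icc 0 T, inner ℝ ((1 / 2 : ℝ) • u t + (1 / 2 : ℝ) • v t) (ψ t))
  rw [add_zero] at h3
  refine h3.congr fun k => ?_
  rw [← integral_add h1]
  · refine integral_congr_ae (ae_of_all _ fun t => ?_)
    simp only [comp_switch u v k t (fun y => inner ℝ y (ψ t))]
    rw [inner_add_left, inner_smul_left, inner_smul_left]
    simp
  · exact h2.bdd_smul 1 (measurable_squareWave _).aestronglyMeasurable
      (ae_of_all _ fun s => by rw [Real.norm_eq_abs, abs_squareWave])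

theorem weakL2Tendsto_of_ae_tendsto {uk : ℕ → ℝ → Vec m} {u : ℝ → Vec m}
    (hU : Bornology.IsBounded U) (huk : ∀ k, IsControl T U (uk k)) (hu : IsControl T U u)
    (h : ∀ᵐ t ∂(timeMeasure T), Tendsto (fun k => uk k t) atTop (𝓝 (u t))) :
    WeakL2Tendsto T uk u := by
  refine ⟨fun k => (huk k).memLp hU 2, hu.memLp hU 2, fun ψ hψ => ?_⟩
  obtain ⟨R, hR⟩ := hU.exists_norm_le
  refine tendsto_integral_of_dominated_convergence (fun t => R * ‖ψ t‖)
    (fun k => ((huk k).1.aestronglyMeasurable).inner hψ.1)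
    ((hψ.integrable (by norm_num)).norm.const_mul R) (fun k => ?_) ?_
  · filter_upwards [(huk k).2] with t ht
    exact (norm_inner_le_norm _ _).trans (mul_le_mul_of_nonneg_right (hR _ ht) (norm_nonneg _))
  · filter_upwards [h] with t ht
    exact ht.inner tendsto_const_nhds

end Controls

/-! ### The integral mapping is affine in the control. -/

section Affine

variable {n m : ℕ} {T : ℝ} {U : Set (Vec m)} {g : ℝ → ℝ → Vec n → Vec m → Vec n}

/-- The limit along the switching controls is computed twice. Norm-weak continuity gives the value
at the weak limit, the midpoint; the decomposition `comp_switch` of the kernel itself gives the mean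
of the two values. -/
theorem integralMap_midpoint (hU : Bornology.IsBounded U) (hUc : Convex ℝ U)
    (hG : NormWeakContinuous T U g) {x : ℝ → Vec n} (hx : ContinuousOn x (Icc 0 T))
    {u v : ℝ → Vec m} (hu : IsControl T U u) (hv : IsControl T U v) {t : ℝ} (ht : t ∈ Icc 0 T) :
    integralMap g x (fun s => (1 / 2 : ℝ) • u s + (1 / 2 : ℝ) • v s) t =
      (1 / 2 : ℝ) • integralMap g x u t + (1 / 2 : ℝ) • integralMap g x v t := by
  have hmid := hu.combo hUc hv (a := 1 / 2) (b := 1 / 2) (by norm_num) (by norm_num) (by norm_num)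
  have h1 := hG.tendsto (fun _ => x) x (switch u v) _ (fun _ => hx) hx
    (fun V hV => Eventually.of_forall fun k s _ => refl_mem_uniformity hV)
    (hu.switch hv) hmid (weakL2Tendsto_switch hU hUc hu hv) t ht
  refine tendsto_nhds_unique h1 ?_
  have iu := hG.integrable x u hx hu t ht
  have iv := hG.integrable x v hx hv t ht
  have iS : IntegrableOn (fun s => (1 / 2 : ℝ) • (g t s (x s) (u s) - g t s (x s) (v s)))
      (Ioc 0 t) := ((iu.sub iv).smul (1 / 2 : ℝ)).1
  have h3 := (tendsto_setIntegral_squareWave_smul measurableSet_Ioc iS).const_add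
    ((1 / 2 : ℝ) • integralMap g x u t + (1 / 2 : ℝ) • integralMap g x v t)
  rw [add_zero] at h3
  refine h3.congr fun k => ?_
  have e1 : integralMap g x (switch u v k) t = ∫ s in Ioc 0 t,
      (((1 / 2 : ℝ) • g t s (x s) (u s) + (1 / 2 : ℝ) • g t s (x s) (v s)) +
      squareWave ((k : ℝ) + 1) s • ((1 / 2 : ℝ) • (g t s (x s) (u s) - g t s (x s) (v s)))) := by
    rw [integralMap, intervalIntegral.integral_of_le ht.1]
    exact integral_congr_ae (ae_of_all _ fun s => comp_switch u v k s (g t s (x s)))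
  have iu' : IntegrableOn (fun s => (1 / 2 : ℝ) • g t s (x s) (u s)) (Ioc 0 t) := iu.1.smul (1 / 2 : ℝ)
  have iv' : IntegrableOn (fun s => (1 / 2 : ℝ) • g t s (x s) (v s)) (Ioc 0 t) := iv.1.smul (1 / 2 : ℝ)
  have isum : IntegrableOn (fun s => (1 / 2 : ℝ) • g t s (x s) (u s) +
      (1 / 2 : ℝ) • g t s (x s) (v s)) (Ioc 0 t) := iu'.add iv'
  have iw : IntegrableOn (fun s => squareWave ((k : ℝ) + 1) s •
      ((1 / 2 : ℝ) • (g t s (x s) (u s) - g t s (x s) (v s)))) (Ioc 0 t) := iS.bdd_smul 1 (measurable_squareWave ((k : ℝ) + 1)).aestronglyMeasurable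
      (ae_of_all _ fun s => by rw [Real.norm_eq_abs, abs_squareWave])
  rw [e1, integral_add isum iw, integral_add iu' iv',
    integral_smul, integral_smul, integralMap, integralMap, intervalIntegral.integral_of_le ht.1,
    intervalIntegral.integral_of_le ht.1]

/-- A continuous midpoint-affine function on `[0,1]` that vanishes at the end points is zero. -/
theorem eq_zero_of_midpoint {E : Type*} [NormedAddCommGroup E] [NormedSpace ℝ E] {h : ℝ → E}
    (hc : ContinuousOn h (Icc 0 1))
    (hm : ∀ a ∈ Icc (0 : ℝ) 1, ∀ b ∈ Icc (0 : ℝ) 1,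
      h ((1 / 2) * a + (1 / 2) * b) = (1 / 2 : ℝ) • h a + (1 / 2 : ℝ) • h b)
    (h0 : h 0 = 0) (h1 : h 1 = 0) {c : ℝ} (hc' : c ∈ Icc (0 : ℝ) 1) : h c = 0 := by
  -- A maximizer of the norm is the midpoint of an end point, where `h` vanishes, and another point
  -- of `[0,1]`; so the maximum is at most half of itself.
  obtain ⟨a, ha, hmax⟩ := isCompact_Icc.exists_isMaxOn (nonempty_Icc.2 zero_le_one) hc.norm
  have hle : ∀ b ∈ Icc (0 : ℝ) 1, ‖h b‖ ≤ ‖h a‖ := fun b hb => hmax hb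
  have hha : ‖h a‖ ≤ 0 := by
    rcases le_total a (1 / 2) with h2 | h2
    · have hb : 2 * a ∈ Icc (0 : ℝ) 1 := ⟨by linarith [ha.1], by linarith⟩
      have e := hm 0 (by simp) (2 * a) hb
      rw [h0, smul_zero, zero_add, show (1 / 2 : ℝ) * 0 + 1 / 2 * (2 * a) = a by ring] at e
      have := congrArg norm e
      rw [norm_smul] at this
      norm_num at this
      linarith [hle _ hb, norm_nonneg (h a)]
    · have hb : 2 * a - 1 ∈ Icc (0 : ℝ) 1 := ⟨by linarith, by linarith [ha.2]⟩
      have e := hm 1 (by simp) (2 * a - 1) hb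
      rw [h1, smul_zero, zero_add, show (1 / 2 : ℝ) * 1 + 1 / 2 * (2 * a - 1) = a by ring] at e
      have := congrArg norm e
      rw [norm_smul] at this
      norm_num at this
      linarith [hle _ hb, norm_nonneg (h a)]
  exact norm_le_zero_iff.1 ((hle c hc').trans hha)

/-- Along the segment from `v` to `u` the mapping is continuous, since bounded pointwise convergent
controls converge weakly; its deviation from the affine interpolation is midpoint-affine and
vanishes at both ends. -/
theorem integralMap_combo (hU : Bornology.IsBounded U) (hUc : Convex ℝ U)
    (hG : NormWeakContinuous T U g) {x : ℝ → Vec n} (hx : ContinuousOn x (Icc 0 T))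
    {u v : ℝ → Vec m} (hu : IsControl T U u) (hv : IsControl T U v) {t : ℝ} (ht : t ∈ Icc 0 T)
    {c : ℝ} (hc : c ∈ Icc (0 : ℝ) 1) :
    integralMap g x (fun s => c • u s + (1 - c) • v s) t =
      c • integralMap g x u t + (1 - c) • integralMap g x v t := by
  have hctl : ∀ c ∈ Icc (0 : ℝ) 1, IsControl T U (fun s => c • u s + (1 - c) • v s) :=
    fun c hc => hu.combo hUc hv hc.1 (by linarith [hc.2]) (by ring)
  have hcont : ContinuousOn (fun c : ℝ => integralMap g x (fun s => c • u s + (1 - c) • v s) t)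
      (Icc 0 1) := by
    rw [continuousOn_iff_continuous_domRestrict]
    refine continuous_iff_seqContinuous.2 fun c c₀ hlim => ?_
    have hlim' : Tendsto (fun k => (c k : ℝ)) atTop (𝓝 c₀) := (continuous_subtype_val.tendsto _).comp hlim
    refine hG.tendsto (fun _ => x) x _ _ (fun _ => hx) hx
      (fun V hV => Eventually.of_forall fun k s _ => refl_mem_uniformity hV)
      (fun k => hctl _ (c k).2) (hctl _ c₀.2) ?_ t ht
    refine weakL2Tendsto_of_ae_tendsto hU (fun k => hctl _ (c k).2) (hctl _ c₀.2)
      (ae_of_all _ fun s => ?_)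
    exact (hlim'.smul_const _).add ((hlim'.const_sub 1).smul_const _)
  have := eq_zero_of_midpoint (h := fun c : ℝ =>
    integralMap g x (fun s => c • u s + (1 - c) • v s) t -
      (c • integralMap g x u t + (1 - c) • integralMap g x v t))
    (hcont.sub (by fun_prop)) ?_ ?_ ?_ hc
  · exact sub_eq_zero.1 this
  · intro a ha b hb
    have e := integralMap_midpoint hU hUc hG hx (hctl a ha) (hctl b hb) ht
    have e' : (fun s => (1 / 2 : ℝ) • (a • u s + (1 - a) • v s) +
        (1 / 2 : ℝ) • (b • u s + (1 - b) • v s)) =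
        fun s => (1 / 2 * a + 1 / 2 * b) • u s + (1 - (1 / 2 * a + 1 / 2 * b)) • v s := by
      funext s; module
    rw [e'] at e
    simp only [e]
    module
  · simp
  · simp

/-- Controls that agree off `E` contribute the same integral there, which cancels; this localizes
affinity to constant values on `E`. -/
theorem setIntegral_kernel_combo (hU : Bornology.IsBounded U) (hUc : Convex ℝ U)
    (hG : NormWeakContinuous T U g) {x : ℝ → Vec n} (hx : ContinuousOn x (Icc 0 T))
    {t : ℝ} (ht : t ∈ Icc 0 T) {E : Set ℝ} (hE : MeasurableSet E)
    {a b : Vec m} (ha : a ∈ U) (hb : b ∈ U) {c : ℝ} (hc : c ∈ Icc (0 : ℝ) 1) :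
    ∫ s in Ioc 0 t ∩ E, g t s (x s) (c • a + (1 - c) • b) =
      c • (∫ s in Ioc 0 t ∩ E, g t s (x s) a) + (1 - c) • ∫ s in Ioc 0 t ∩ E, g t s (x s) b := by
  classical
  have hctl : ∀ p ∈ U, IsControl T U (E.piecewise (fun _ => p) (fun _ => a)) := by
    intro p hp
    refine ⟨(measurable_const.piecewise hE measurable_const).aemeasurable, ae_of_all _ fun s => ?_⟩
    by_cases hs : s ∈ E <;> simp [hs, hp, ha]
  have hmap : ∀ p ∈ U, integralMap g x (E.piecewise (fun _ => p) (fun _ => a)) t =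
      (∫ s in Ioc 0 t ∩ E, g t s (x s) p) + ∫ s in Ioc 0 t \ E, g t s (x s) a := by
    intro p hp
    rw [integralMap, intervalIntegral.integral_of_le ht.1,
      ← integral_inter_add_sdiff hE (hG.integrable x _ hx (hctl p hp) t ht).1]
    congr 1
    · exact setIntegral_congr_fun (measurableSet_Ioc.inter hE) fun s hs => by simp [hs.2]
    · exact setIntegral_congr_fun (measurableSet_Ioc.diff hE) fun s hs => by simp [hs.2]
  have hab : c • a + (1 - c) • b ∈ U := hUc ha hb hc.1 (by linarith [hc.2]) (by ring)
  have e := integralMap_combo hU hUc hG hx (hctl a ha) (hctl b hb) ht hc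
  have e' : (fun s => c • E.piecewise (fun _ => a) (fun _ => a) s +
      (1 - c) • E.piecewise (fun _ => b) (fun _ => a) s) =
      E.piecewise (fun _ => c • a + (1 - c) • b) (fun _ => a) := by
    funext s
    by_cases hs : s ∈ E
    · simp [hs]
    · simp [hs, ← add_smul]
  rw [e', hmap _ hab, hmap _ ha, hmap _ hb] at e
  set A := ∫ s in Ioc 0 t \ E, g t s (x s) a
  have e2 := congrArg (fun y => y - A) e
  simp only [add_sub_cancel_right] at e2
  rw [e2]
  module

end Affine

/-! ### A bound on the integral mapping uniform in the control. -/

/-- On a bounded convex set in finite dimensions, convex-affine maps are controlled, uniformly, by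
their values at finitely many points. -/
theorem exists_finset_norm_le_of_affine {E : Type*} [NormedAddCommGroup E] [NormedSpace ℝ E]
    [FiniteDimensional ℝ E] (V : Type*) [NormedAddCommGroup V] [NormedSpace ℝ V] {U : Set E}
    (hUc : Convex ℝ U) (hU : Bornology.IsBounded U) (hne : U.Nonempty) :
    ∃ (S : Finset E) (K : ℝ), (∀ a ∈ S, a ∈ U) ∧ 0 ≤ K ∧ ∀ f : E → V,
      (∀ a ∈ U, ∀ b ∈ U, ∀ c ∈ Icc (0 : ℝ) 1, f (c • a + (1 - c) • b) = c • f a + (1 - c) • f b) →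
        ∀ u ∈ U, ‖f u‖ ≤ K * ∑ a ∈ S, ‖f a‖ := by
  classical
  obtain ⟨u₀, hu₀⟩ := hne
  -- The basis is taken from `U - u₀` itself, so the simplex with vertices `u₀` and `u₀ + i` lies in
  -- `U`. Its vertices form `S`.
  obtain ⟨b, hbU, hspan, hli⟩ := exists_linearIndependent ℝ ((fun u => u - u₀) '' U)
  have hbfin : b.Finite := hli.setFinite
  have : Fintype b := hbfin.fintype
  let Φ : (b → ℝ) →ₗ[ℝ] E := Fintype.linearCombination ℝ (Subtype.val : b → E)
  have hΦ : ∀ c, Φ c = ∑ i, c i • (i : E) := fun c => Fintype.linearCombination_apply ℝ _ c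
  have hker : LinearMap.ker Φ = ⊥ := by
    rw [LinearMap.ker_eq_bot]
    exact linearIndependent_iff_injective_fintypeLinearCombination.1 hli
  obtain ⟨L, -, hL⟩ := Φ.exists_antilipschitzWith hker
  obtain ⟨R, hR⟩ := hU.exists_norm_le
  have hR0 : 0 ≤ R := (norm_nonneg _).trans (hR u₀ hu₀)
  set M : ℝ := L * (R + R) with hM
  have hM0 : 0 ≤ M := by positivity
  have hcoord : ∀ u ∈ U, ∃ c : b → ℝ, Φ c = u - u₀ ∧ ∀ i, |c i| ≤ M := by
    intro u hu
    have h1 : u - u₀ ∈ Submodule.span ℝ b := by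
      rw [hspan]; exact Submodule.subset_span ⟨u, hu, rfl⟩
    have h2 : u - u₀ ∈ LinearMap.range Φ := by
      rw [Fintype.range_linearCombination, Subtype.range_coe]; exact h1
    obtain ⟨c, hc⟩ := h2
    refine ⟨c, hc, fun i => ?_⟩
    have h3 := hL.le_mul_dist c 0
    rw [map_zero, dist_zero_right, dist_zero_right, hc] at h3
    calc |c i| = ‖c i‖ := rfl
      _ ≤ ‖c‖ := norm_le_pi_norm c i
      _ ≤ L * ‖u - u₀‖ := h3
      _ ≤ M := mul_le_mul_of_nonneg_left ((norm_sub_le _ _).trans (add_le_add (hR u hu) (hR u₀ hu₀)))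
          L.2
  let p : Option b → E := fun o => o.elim u₀ (fun i => u₀ + i)
  have hpU : ∀ o, p o ∈ U := by
    rintro (_ | i)
    · exact hu₀
    · obtain ⟨u, hu, hi⟩ := hbU i.2
      simp only [p, Option.elim, ← hi]
      simpa using hu
  let S : Finset E := Finset.univ.image p
  have hSU : ∀ a ∈ S, a ∈ U := by
    intro a ha
    obtain ⟨o, -, rfl⟩ := Finset.mem_image.1 ha
    exact hpU o
  have hull : ∀ ρ : b → ℝ, (∀ i, 0 ≤ ρ i) → ∑ i, ρ i ≤ 1 → u₀ + Φ ρ ∈ convexHull ℝ (S : Set E) := by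
    intro ρ h0 h1
    have := (convex_convexHull ℝ (S : Set E)).sum_mem (t := Finset.univ)
      (w := fun o : Option b => o.elim (1 - ∑ i, ρ i) ρ) (z := p) ?_ ?_ ?_
    · convert this using 1
      simp only [Fintype.sum_option, p, Option.elim, smul_add, Finset.sum_add_distrib, hΦ,
        ← Finset.sum_smul]
      module
    · rintro (_ | i) -
      exacts [sub_nonneg.2 h1, h0 i]
    · simp [Fintype.sum_option]
    · intro o _
      exact subset_convexHull ℝ _ (Finset.mem_coe.2 (Finset.mem_image_of_mem p (Finset.mem_univ o)))
  set d : ℝ := (Fintype.card b : ℝ) with hd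
  have hd0 : 0 ≤ d := by positivity
  -- Coordinates of points of `U` are bounded by `M`. This `ε` is small enough that moving the
  -- barycentre `z` of the simplex away from any `u ∈ U`, to `w = z + ε (z - u)`, stays in the
  -- simplex.
  set ε : ℝ := 1 / ((d + 1) * (1 + (d + 1) * M)) with hε
  have hε0 : 0 < ε := by positivity
  have hε1 : ε * (1 + (d + 1) * M) = 1 / (d + 1) := by rw [hε]; field_simp
  -- Affinity on the segment from `w` to `u` gives `ε f(u) = (1 + ε) f(z) - f(w)`, and on the
  -- simplex `‖f‖` is at most the sum over the vertices; hence the constant.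
  refine ⟨S, (2 + ε) / ε, hSU, by positivity, fun f hf u hu => ?_⟩
  have hconv : ConvexOn ℝ U (fun a => ‖f a‖) := by
    refine ⟨hUc, fun a ha a' ha' s t hs ht hst => ?_⟩
    obtain rfl : t = 1 - s := by linarith
    simp only [smul_eq_mul]
    rw [hf a ha a' ha' s ⟨hs, by linarith⟩]
    refine (norm_add_le _ _).trans_eq ?_
    rw [norm_smul, norm_smul, Real.norm_of_nonneg hs, Real.norm_of_nonneg ht]
  have hbound : ∀ a ∈ convexHull ℝ (S : Set E), ‖f a‖ ≤ ∑ a ∈ S, ‖f a‖ := by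
    intro a ha
    obtain ⟨y, hy, hay⟩ := hconv.exists_ge_of_mem_convexHull (fun a h => hSU a h) ha
    exact hay.trans (Finset.single_le_sum (f := fun a => ‖f a‖) (fun _ _ => norm_nonneg _) hy)
  obtain ⟨c, hc, hcM⟩ := hcoord u hu
  have hd1 : d * (1 / (d + 1)) + 1 / (d + 1) = 1 := by field_simp
  have hz := hull (fun _ => 1 / (d + 1)) (fun _ => by positivity) (by
    rw [Finset.sum_const, nsmul_eq_mul, Finset.card_univ]
    have : 0 < 1 / (d + 1) := by positivity
    linarith)
  have hw := hull (fun i => 1 / (d + 1) + ε * (1 / (d + 1) - c i)) (fun i => by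
    have h1 := (abs_le.1 (hcM i)).2
    have h2 : ε * c i ≤ ε * M := mul_le_mul_of_nonneg_left h1 hε0.le
    have h3 : 0 ≤ ε * (1 + d * M) := by positivity
    have h4 : 0 ≤ ε * (1 / (d + 1)) := by positivity
    nlinarith) (by
    have h1 : ∀ i, 1 / (d + 1) + ε * (1 / (d + 1) - c i) ≤ 1 / (d + 1) + ε * (1 / (d + 1) + M) := by
      intro i
      have := (abs_le.1 (hcM i)).1
      gcongr
      linarith
    refine (Finset.sum_le_sum fun i _ => h1 i).trans ?_
    rw [Finset.sum_const, nsmul_eq_mul, Finset.card_univ, ← hd]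
    have h5 : 0 < 1 / (d + 1) := by positivity
    have h6 : ε * (d * (1 / (d + 1))) ≤ ε * 1 := mul_le_mul_of_nonneg_left (by linarith) hε0.le
    have h7 : 0 ≤ ε * M := by positivity
    nlinarith)
  set z := u₀ + Φ (fun _ => 1 / (d + 1)) with hz_def
  set w := u₀ + Φ (fun i => 1 / (d + 1) + ε * (1 / (d + 1) - c i)) with hw_def
  have hUhull : convexHull ℝ (S : Set E) ⊆ U := convexHull_min (fun a h => hSU a h) hUc
  have hw_eq : w = z + ε • (z - u) := by
    have : (fun i => 1 / (d + 1) + ε * (1 / (d + 1) - c i)) =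
        (fun _ : b => 1 / (d + 1)) + ε • ((fun _ : b => 1 / (d + 1)) - c) := by
      funext i; simp
    rw [hw_def, this, map_add, map_smul, map_sub, hc, hz_def]
    module
  have hz_eq : z = (1 / (1 + ε)) • w + (1 - 1 / (1 + ε)) • u := by
    have h1 : (1 + ε) ≠ 0 := by positivity
    have h2 : (1 - 1 / (1 + ε)) = ε / (1 + ε) := by field_simp; ring
    have h3 : z = (1 / (1 + ε) * (1 + ε)) • z := by rw [one_div, inv_mul_cancel₀ h1, one_smul]
    rw [hw_eq, h2]
    nth_rewrite 1 [h3]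
    rw [div_eq_mul_one_div ε]
    module
  have hfz := hf w (hUhull hw) u hu (1 / (1 + ε)) ⟨by positivity, by
    rw [div_le_one (by positivity)]; linarith⟩
  rw [← hz_eq] at hfz
  have hfu : ε • f u = (1 + ε) • f z - f w := by
    have h1 : (1 + ε) ≠ 0 := by positivity
    rw [hfz, smul_add, smul_smul, smul_smul, mul_one_div_cancel h1, mul_sub, mul_one_div_cancel h1]
    module
  have hn : ε * ‖f u‖ ≤ (1 + ε) * ‖f z‖ + ‖f w‖ := by
    have := congrArg norm hfu
    rw [norm_smul, Real.norm_of_nonneg hε0.le] at this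
    rw [this]
    refine (norm_sub_le _ _).trans_eq ?_
    rw [norm_smul, Real.norm_of_nonneg (by positivity)]
  have h8 := hbound z hz
  have h9 := hbound w hw
  rw [div_mul_eq_mul_div, le_div_iff₀ hε0]
  nlinarith [mul_le_mul_of_nonneg_left h8 (show (0 : ℝ) ≤ 1 + ε by positivity)]

section

variable {n m : ℕ} {T : ℝ} {U : Set (Vec m)} {g : ℝ → ℝ → Vec n → Vec m → Vec n}

theorem measurableSet_triangle (T : ℝ) : MeasurableSet (triangle T) := by
  have : triangle T = (Icc 0 T ×ˢ Icc 0 T) ∩ {p : ℝ × ℝ | p.2 ≤ p.1} := by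
    ext p; simp only [triangle, mem_ofPred_eq, mem_inter_iff, mem_prod, and_assoc]
  rw [this]
  exact (measurableSet_Icc.prod measurableSet_Icc).inter
    (measurableSet_le measurable_snd measurable_fst)

/-- Sections of an integrable function on the triangle. -/
theorem integrableOn_triangle_sections {σ : ℝ × ℝ → ℝ} (hσ : IntegrableOn σ (triangle T)) :
    (∀ᵐ t ∂(timeMeasure T), IntegrableOn (fun s => σ (t, s)) (Ioc 0 t)) ∧
      IntegrableOn (fun t => ∫ s in Ioc 0 t, σ (t, s)) (Icc 0 T) := by
  have h1 : Integrable ((triangle T).indicator σ) ((volume : Measure ℝ).prod volume) :=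
    (integrable_indicator_iff (measurableSet_triangle T)).2 hσ
  have hsec : ∀ t ∈ Icc 0 T, (fun s => (triangle T).indicator σ (t, s)) =
      (Icc 0 t).indicator fun s => σ (t, s) := by
    intro t ht
    funext s
    by_cases hs : s ∈ Icc 0 t
    · rw [indicator_of_mem hs, indicator_of_mem]
      exact ⟨ht, ⟨hs.1, hs.2.trans ht.2⟩, hs.2⟩
    · rw [indicator_of_notMem hs, indicator_of_notMem]
      exact fun h => hs ⟨h.2.1.1, h.2.2⟩
  constructor
  · filter_upwards [ae_restrict_of_ae h1.prod_right_ae, ae_restrict_mem measurableSet_Icc]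
      with t h2 ht
    rw [hsec t ht, integrable_indicator_iff measurableSet_Icc] at h2
    exact h2.mono_set Ioc_subset_Icc_self
  · refine (h1.integral_prod_left.integrableOn (s := Icc 0 T)).congr ?_
    filter_upwards [ae_restrict_mem measurableSet_Icc] with t ht
    rw [hsec t ht, integral_indicator measurableSet_Icc, integral_Icc_eq_integral_Ioc]

/-- A bound on the integral mapping that is uniform over all controls. -/
theorem exists_integralMap_bound (hU : Bornology.IsBounded U)
    (hUc : Convex ℝ U) (hne : U.Nonempty)
    (hg : ∀ u ∈ U, HypKernel T (fun t s x => g t s x u)) (hG : NormWeakContinuous T U g) :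
    ∃ S : ℝ → ℝ, IntegrableOn S (Icc 0 T) ∧ (∀ t ∈ Icc 0 T, 0 ≤ S t) ∧
      ∀ᵐ t ∂(timeMeasure T), ∀ (x : ℝ → Vec n) (u : ℝ → Vec m), ContinuousOn x (Icc 0 T) →
        IsControl T U u → ∀ M, (∀ s ∈ Icc 0 t, ‖x s‖ ≤ M) →
          ‖integralMap g x u t‖ ≤ S t * (1 + M) := by
  classical
  obtain ⟨A, K, hAU, hK, hA⟩ := exists_finset_norm_le_of_affine (Vec n) hUc hU hne
  have hσ : ∀ a : Vec m, ∃ σ : ℝ × ℝ → ℝ, a ∈ A → (∀ p ∈ triangle T, 0 ≤ σ p) ∧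
      IntegrableOn σ (triangle T) ∧ ∀ t s, (t, s) ∈ triangle T → ∀ x : Vec n,
        ‖g t s x a‖ ≤ σ (t, s) * (1 + ‖x‖) := by
    intro a
    by_cases ha : a ∈ A
    · obtain ⟨σ, h⟩ := (hg a (hAU a ha)).growth
      exact ⟨σ, fun _ => h⟩
    · exact ⟨0, fun h => absurd h ha⟩
  choose σ hσ using hσ
  have htri : ∀ t ∈ Icc 0 T, ∀ s ∈ Ioc 0 t, (t, s) ∈ triangle T := fun t ht s hs =>
    ⟨ht, ⟨hs.1.le, hs.2.trans ht.2⟩, hs.2⟩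
  refine ⟨fun t => K * ∑ a ∈ A, ∫ s in Ioc 0 t, σ a (t, s),
    (integrable_finsetSum _ fun a ha =>
      (integrableOn_triangle_sections (hσ a ha).2.1).2).const_mul K, fun t ht =>
    mul_nonneg hK (Finset.sum_nonneg fun a ha => setIntegral_nonneg measurableSet_Ioc fun s hs =>
      (hσ a ha).1 _ (htri t ht s hs)), ?_⟩
  have hall : ∀ᵐ t ∂(timeMeasure T), ∀ a ∈ A, IntegrableOn (fun s => σ a (t, s)) (Ioc 0 t) :=
    (ae_ball_iff A.countable_toSet).2 fun a ha => (integrableOn_triangle_sections (hσ a ha).2.1).1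
  filter_upwards [hall, ae_restrict_mem measurableSet_Icc] with t hint ht x u hx hu M hM
  set H : ℝ → ℝ := fun s => K * ∑ a ∈ A, σ a (t, s) * (1 + M) with hH
  have hHi : IntegrableOn H (Ioc 0 t) :=
    (integrable_finsetSum _ fun a ha => (hint a ha).mul_const _).const_mul K
  have hHint : ∫ s in Ioc 0 t, H s = K * (∑ a ∈ A, ∫ s in Ioc 0 t, σ a (t, s)) * (1 + M) := by
    rw [hH, integral_const_mul, integral_finsetSum _ fun a ha => (hint a ha).mul_const _,
      mul_assoc, Finset.sum_mul]
    simp_rw [integral_mul_const]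
  rw [← hHint]
  -- The bound is by an integral over the same set `E`, hence additive: summing over the level sets
  -- of a simple control costs no factor depending on the number of its values.
  have hlocal : ∀ a ∈ U, ∀ E, MeasurableSet E →
      ‖∫ s in Ioc 0 t ∩ E, g t s (x s) a‖ ≤ ∫ s in Ioc 0 t ∩ E, H s := by
    intro a ha E hE
    have hsub : Ioc 0 t ∩ E ⊆ Ioc 0 t := inter_subset_left
    refine (hA (fun a => ∫ s in Ioc 0 t ∩ E, g t s (x s) a) (fun a ha b hb c hc =>
      setIntegral_kernel_combo hU hUc hG hx ht hE ha hb hc) a ha).trans ?_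
    rw [hH, integral_const_mul, integral_finsetSum _ fun a ha =>
      ((hint a ha).mono_set hsub).mul_const _]
    refine mul_le_mul_of_nonneg_left (Finset.sum_le_sum fun a' ha' => ?_) hK
    refine norm_integral_le_of_norm_le (((hint a' ha').mono_set hsub).mul_const _) ?_
    filter_upwards [ae_restrict_mem (measurableSet_Ioc.inter hE)] with s hs
    have hst := htri t ht s hs.1
    exact ((hσ a' ha').2.2 t s hst (x s)).trans (mul_le_mul_of_nonneg_left
      (by linarith [hM s (Ioc_subset_Icc_self hs.1)]) ((hσ a' ha').1 _ hst))
  have hsimple : ∀ v : SimpleFunc ℝ (Vec m), (∀ s, v s ∈ U) →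
      ‖integralMap g x v t‖ ≤ ∫ s in Ioc 0 t, H s := by
    intro v hv
    have hvc : IsControl T U v := ⟨v.measurable.aemeasurable, ae_of_all _ hv⟩
    have hmeas : ∀ y ∈ v.range, MeasurableSet (Ioc 0 t ∩ v ⁻¹' {y}) := fun y _ =>
      measurableSet_Ioc.inter (v.measurableSet_fiber y)
    have hdisj : (v.range : Set (Vec m)).PairwiseDisjoint fun y => Ioc 0 t ∩ v ⁻¹' {y} := by
      intro y _ y' _ hyy
      refine Set.disjoint_left.2 fun s hs hs' => hyy ?_
      rw [← hs.2, ← hs'.2]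
    have hcover : Ioc 0 t = ⋃ y ∈ v.range, Ioc 0 t ∩ v ⁻¹' {y} := by
      ext s
      simp only [mem_iUnion, exists_prop]
      exact ⟨fun h => ⟨v s, v.mem_range_self s, h, rfl⟩, fun ⟨y, _, h⟩ => h.1⟩
    have hgi := (hG.integrable x v hx hvc t ht).1
    rw [integralMap, intervalIntegral.integral_of_le ht.1, hcover,
      integral_biUnion_finset _ hmeas hdisj fun y _ => hgi.mono_set inter_subset_left,
      integral_biUnion_finset _ hmeas hdisj fun y _ => hHi.mono_set inter_subset_left]
    refine (norm_sum_le _ _).trans (Finset.sum_le_sum fun y hy => ?_)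
    obtain ⟨s₀, rfl⟩ := SimpleFunc.mem_range.1 hy
    rw [setIntegral_congr_fun (g := fun s => g t s (x s) (v s₀))
      (measurableSet_Ioc.inter (v.measurableSet_fiber _)) fun s hs => by rw [show v s = v s₀ from hs.2]]
    exact hlocal _ (hv s₀) _ (v.measurableSet_fiber _)
  obtain ⟨u₀, hu₀⟩ := hne
  obtain ⟨v, hvm, hv⟩ := hu.1
  -- A general control is the almost everywhere limit of simple `U`-valued controls, hence their
  -- weak limit, and the bound passes to it by norm-weak continuity.
  let vk : ℕ → SimpleFunc ℝ (Vec m) := SimpleFunc.approxOn v hvm U u₀ hu₀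
  have hvk : ∀ k s, vk k s ∈ U := fun k s => SimpleFunc.approxOn_mem hvm hu₀ k s
  have hlim := hG.tendsto (fun _ => x) x (fun k => vk k) u (fun _ => hx) hx
    (fun V hV => Eventually.of_forall fun k s _ => refl_mem_uniformity hV)
    (fun k => ⟨(vk k).measurable.aemeasurable, ae_of_all _ (hvk k)⟩) hu
    (weakL2Tendsto_of_ae_tendsto hU
      (fun k => ⟨(vk k).measurable.aemeasurable, ae_of_all _ (hvk k)⟩) hu (by
        filter_upwards [hv, hu.2] with s h1 h2
        rw [h1] at h2 ⊢
        exact SimpleFunc.tendsto_approxOn hvm hu₀ (subset_closure h2))) t ht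
  exact le_of_tendsto hlim.norm (Eventually.of_forall fun k => hsimple (vk k) (hvk k))

end

/-! ### Absolutely continuous functions, Gronwall and Arzelà–Ascoli. -/

section AbsolutelyContinuous

variable {n : ℕ} {T : ℝ} {x : ℝ → Vec n}

/-- Lebesgue differentiation at interior points. The end points are discarded because `deriv` is
two-sided and `x` is unconstrained outside `[0,T]`. -/
theorem ae_deriv_eq_of_eq_integral (hT : 0 < T) {x₀ : Vec n} {f : ℝ → Vec n}
    (hf : IntegrableOn f (Icc 0 T)) (hx : ∀ t ∈ Icc 0 T, x t = x₀ + ∫ s in (0 : ℝ)..t, f s) :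
    deriv x =ᵐ[timeMeasure T] f := by
  have hfi : IntervalIntegrable f volume 0 T :=
    (intervalIntegrable_iff_integrableOn_Icc_of_le hT.le).2 hf
  have h0 : ∀ᵐ t : ℝ, t ≠ 0 := by simp [ae_iff, measure_singleton]
  have hT' : ∀ᵐ t : ℝ, t ≠ T := by simp [ae_iff, measure_singleton]
  filter_upwards [ae_restrict_of_ae hfi.ae_hasDerivAt_integral, ae_restrict_of_ae h0,
    ae_restrict_of_ae hT', ae_restrict_mem measurableSet_Icc] with t ht ht0 htT htm
  rw [uIcc_of_le hT.le] at ht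
  have h1 := (ht htm 0 (left_mem_Icc.2 hT.le)).const_add x₀
  refine (h1.congr_of_eventuallyEq ?_).deriv
  have : Ioo 0 T ∈ 𝓝 t := Ioo_mem_nhds (lt_of_le_of_ne htm.1 ht0.symm) (lt_of_le_of_ne htm.2 htT)
  filter_upwards [this] with s hs using hx s (Ioo_subset_Icc_self hs)

theorem IsAC.integrableOn_deriv (hT : 0 < T) (h : IsAC T x) :
    IntegrableOn (deriv x) (Icc 0 T) := by
  obtain ⟨x₀, f, hf, hx⟩ := h
  exact hf.congr (ae_deriv_eq_of_eq_integral hT hf hx).symm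

theorem IsAC.sub_eq_integral (hT : 0 < T) (h : IsAC T x) {s t : ℝ} (hs : s ∈ Icc 0 T)
    (ht : t ∈ Icc 0 T) : x t - x s = ∫ r in s..t, deriv x r := by
  have hd := h.integrableOn_deriv hT
  obtain ⟨x₀, f, hf, hx⟩ := h
  have hii : ∀ t ∈ Icc 0 T, IntervalIntegrable f volume 0 t := fun t ht =>
    (intervalIntegrable_iff_integrableOn_Icc_of_le ht.1).2 (hf.mono_set (Icc_subset_Icc_right ht.2))
  rw [hx t ht, hx s hs, add_sub_add_left_eq_sub,
    intervalIntegral.integral_interval_sub_left (hii t ht) (hii s hs)]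
  refine intervalIntegral.integral_congr_ae ?_
  have := (ae_restrict_iff' measurableSet_Icc).1 (ae_deriv_eq_of_eq_integral hT hf hx)
  filter_upwards [this] with r hr hrm
  exact (hr (uIcc_subset_Icc hs ht (uIoc_subset_uIcc hrm))).symm

theorem continuousOn_integral_of_integrableOn {E : Type*} [NormedAddCommGroup E] [NormedSpace ℝ E]
    {f : ℝ → E} (hT : 0 < T) (hf : IntegrableOn f (Icc 0 T)) :
    ContinuousOn (fun t => ∫ s in (0 : ℝ)..t, f s) (Icc 0 T) := by
  have := intervalIntegral.continuousOn_primitive_interval' (μ := volume) (f := f) (a := 0)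
    (b₁ := 0) (b₂ := T) ((intervalIntegrable_iff_integrableOn_Icc_of_le hT.le).2 hf) left_mem_uIcc
  rwa [uIcc_of_le hT.le] at this

theorem IsAC.continuousOn (hT : 0 < T) (h : IsAC T x) : ContinuousOn x (Icc 0 T) := by
  obtain ⟨x₀, f, hf, hx⟩ := h
  exact ((continuousOn_integral_of_integrableOn hT hf).const_add x₀).congr hx

theorem IsAC.norm_sub_le (hT : 0 < T) (h : IsAC T x) {ψ : ℝ → ℝ} {s t : ℝ}
    (hs : s ∈ Icc 0 T) (ht : t ∈ Icc 0 T) (hst : s ≤ t) (hψ : IntegrableOn ψ (Icc 0 T))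
    (hd : ∀ᵐ r ∂volume, r ∈ Ioc s t → ‖deriv x r‖ ≤ ψ r) : ‖x t - x s‖ ≤ ∫ r in s..t, ψ r := by
  rw [h.sub_eq_integral hT hs ht]
  exact intervalIntegral.norm_integral_le_of_norm_le hst hd
    ((intervalIntegrable_iff_integrableOn_Icc_of_le hst).2 (hψ.mono_set (Icc_subset_Icc hs.1 ht.2)))

/-- A Gronwall estimate with an integrable coefficient and a bound through the past maximum. -/
theorem IsAC.norm_le_of_norm_deriv_le (hT : 0 < T) (h : IsAC T x) {a : ℝ → ℝ}
    (ha : IntegrableOn a (Icc 0 T)) (ha0 : ∀ t ∈ Icc 0 T, 0 ≤ a t)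
    (hd : ∀ᵐ t ∂(timeMeasure T), ∀ M, (∀ s ∈ Icc 0 t, ‖x s‖ ≤ M) → ‖deriv x t‖ ≤ a t * (1 + M))
    {N : ℕ} (hN : ∫ s in (0 : ℝ)..T, a s ≤ N / 2) {t : ℝ} (ht : t ∈ Icc 0 T) :
    1 + ‖x t‖ ≤ 2 ^ N * (1 + ‖x 0‖) := by
  have hc := h.continuousOn hT
  have hii : ∀ s ∈ Icc 0 T, ∀ t ∈ Icc 0 T, IntervalIntegrable a volume s t := fun s hs t ht =>
    (ha.mono_set (uIcc_subset_Icc hs ht)).intervalIntegrable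
  have h0m : (0 : ℝ) ∈ Icc 0 T := left_mem_Icc.2 hT.le
  have hTm : T ∈ Icc 0 T := right_mem_Icc.2 hT.le
  have hmono : ∀ s ∈ Icc 0 T, ∀ t ∈ Icc 0 T, s ≤ t → 0 ≤ ∫ r in s..t, a r := fun s hs t ht hst =>
    intervalIntegral.integral_nonneg hst fun r hr => ha0 r ⟨hs.1.trans hr.1, hr.2.trans ht.2⟩
  have hd' := (ae_restrict_iff' measurableSet_Icc).1 hd
  -- Induction over slices on which `a` has integral at most `1/2`. If the maximum is attained at
  -- `q` in the slice starting at `s`, then `‖x q‖ ≤ ‖x s‖ + (1 + ‖x q‖) / 2`, so `1 + ‖x‖` at most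
  -- doubles per slice.
  have key : ∀ (N : ℕ), ∀ t ∈ Icc 0 T, ∫ s in (0 : ℝ)..t, a s ≤ N / 2 →
      1 + ‖x t‖ ≤ 2 ^ N * (1 + ‖x 0‖) := by
    intro N
    induction N with
    | zero =>
      intro t ht hle
      obtain ⟨s, hs, hmax⟩ := isCompact_Icc.exists_isMaxOn (nonempty_Icc.2 ht.1)
        (hc.mono (Icc_subset_Icc_right ht.2)).norm
      have hsT : s ∈ Icc 0 T := ⟨hs.1, hs.2.trans ht.2⟩
      have h1 := h.norm_sub_le hT (s := 0) (t := s) (ψ := fun r => a r * (1 + ‖x s‖)) h0m hsT hs.1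
        (ha.mul_const _) (by
          filter_upwards [hd'] with r hr hrm
          refine hr ⟨hrm.1.le, hrm.2.trans hsT.2⟩ _ fun q hq => hmax ⟨hq.1, hq.2.trans (hrm.2.trans hs.2)⟩)
      rw [intervalIntegral.integral_mul_const] at h1
      have h2 := intervalIntegral.integral_add_adjacent_intervals (hii 0 h0m s hsT) (hii s hsT t ht)
      have h3 := hmono s hsT t ht hs.2
      have h4 := hmono 0 h0m s hsT hs.1
      have h5 : ∫ r in (0 : ℝ)..s, a r = 0 := by norm_num at hle; linarith
      rw [h5, zero_mul] at h1
      have h6 : ‖x t‖ ≤ ‖x s‖ := hmax ⟨ht.1, le_rfl⟩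
      have h7 := norm_sub_norm_le (x s) (x 0)
      norm_num
      linarith
    | succ N ih =>
      intro t ht hle
      by_cases hsmall : ∫ s in (0 : ℝ)..t, a s ≤ N / 2
      · refine (ih t ht hsmall).trans ?_
        rw [pow_succ]
        have : 0 ≤ 2 ^ N * (1 + ‖x 0‖) := by positivity
        linarith
      · obtain ⟨s, hs, hsv⟩ : (N / 2 : ℝ) ∈ (fun t => ∫ s in (0 : ℝ)..t, a s) '' Icc 0 t := by
          refine intermediate_value_Icc ht.1 ((continuousOn_integral_of_integrableOn hT ha).mono
            (Icc_subset_Icc_right ht.2)) ⟨?_, (not_le.1 hsmall).le⟩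
          simp only [intervalIntegral.integral_same]
          positivity
        have hsT : s ∈ Icc 0 T := ⟨hs.1, hs.2.trans ht.2⟩
        obtain ⟨q, hq, hmax⟩ := isCompact_Icc.exists_isMaxOn (nonempty_Icc.2 ht.1)
          (hc.mono (Icc_subset_Icc_right ht.2)).norm
        have hqT : q ∈ Icc 0 T := ⟨hq.1, hq.2.trans ht.2⟩
        have h6 : ‖x t‖ ≤ ‖x q‖ := hmax ⟨ht.1, le_rfl⟩
        have h9 := ih s hsT hsv.le
        rw [pow_succ]
        rcases le_total q s with hqs | hqs
        · have h10 := ih q hqT (by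
            rw [← hsv]
            have := intervalIntegral.integral_add_adjacent_intervals (hii 0 h0m q hqT)
              (hii q hqT s hsT)
            have := hmono q hqT s hsT hqs
            simp only
            linarith)
          have : 0 ≤ 2 ^ N * (1 + ‖x 0‖) := by positivity
          linarith
        · have h1 := h.norm_sub_le hT (ψ := fun r => a r * (1 + ‖x q‖)) hsT hqT hqs
            (ha.mul_const _) (by
              filter_upwards [hd'] with r hr hrm
              refine hr ⟨hs.1.trans hrm.1.le, hrm.2.trans hqT.2⟩ _ fun p hp =>
                hmax ⟨hp.1, hp.2.trans (hrm.2.trans hq.2)⟩)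
          rw [intervalIntegral.integral_mul_const] at h1
          have h2 := intervalIntegral.integral_add_adjacent_intervals (hii 0 h0m s hsT)
            (hii s hsT q hqT)
          have h3 := intervalIntegral.integral_add_adjacent_intervals (hii 0 h0m q hqT)
            (hii q hqT t ht)
          have h4 := hmono q hqT t ht hq.2
          have h5 : ∫ r in s..q, a r ≤ 1 / 2 := by
            push_cast at hle
            simp only at hsv
            linarith
          have h7 := norm_sub_norm_le (x q) (x s)
          have h8 := mul_le_mul_of_nonneg_right h5 (show 0 ≤ 1 + ‖x q‖ by positivity)
          linarith
  exact key N t ht ((by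
    have := intervalIntegral.integral_add_adjacent_intervals (hii 0 h0m t ht) (hii t ht T hTm)
    have := hmono t ht T hTm ht.2
    linarith : ∫ s in (0 : ℝ)..t, a s ≤ ∫ s in (0 : ℝ)..T, a s).trans hN)

end AbsolutelyContinuous

/-- The Arzelà–Ascoli theorem for sequences of functions on `[0,T]` with a common modulus. -/
theorem exists_subseq_tendstoUniformlyOn {E : Type*} [NormedAddCommGroup E] [ProperSpace E]
    {T : ℝ} (hT : 0 < T) {xk : ℕ → ℝ → E} {R : ℝ} {ω : ℝ → ℝ}
    (hR : ∀ k, ∀ t ∈ Icc 0 T, ‖xk k t‖ ≤ R) (hω : ContinuousOn ω (Icc 0 T))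
    (hmod : ∀ k, ∀ s ∈ Icc 0 T, ∀ t ∈ Icc 0 T, ‖xk k t - xk k s‖ ≤ |ω t - ω s|) :
    ∃ (x : ℝ → E) (ns : ℕ → ℕ), StrictMono ns ∧ ContinuousOn x (Icc 0 T) ∧
      TendstoUniformlyOn (fun k => xk (ns k)) x atTop (Icc 0 T) := by
  have hωc : Continuous fun t : Icc 0 T => ω t := continuousOn_iff_continuous_domRestrict.1 hω
  have hωlim : ∀ s : Icc 0 T, Tendsto (fun t : Icc 0 T => |ω t - ω s|) (𝓝 s) (𝓝 0) := by
    intro s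
    have := ((hωc.tendsto s).sub_const (ω s)).abs
    simpa using this
  have hc : ∀ k, Continuous fun t : Icc 0 T => xk k t := by
    intro k
    refine continuous_iff_continuousAt.2 fun s => ?_
    refine tendsto_iff_norm_sub_tendsto_zero.2 ?_
    exact squeeze_zero (fun _ => norm_nonneg _) (fun t => hmod k s s.2 t t.2) (hωlim s)
  let y : ℕ → BoundedContinuousFunction (Icc 0 T) E := fun k =>
    BoundedContinuousFunction.mkOfCompact ⟨_, hc k⟩
  have heq : Equicontinuous ((↑) : range y → Icc 0 T → E) := by
    intro s
    refine Metric.equicontinuousAt_of_continuity_modulus (fun t : Icc 0 T => |ω t - ω s|) (hωlim s) _ ?_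
    refine Eventually.of_forall fun t => ?_
    rintro ⟨_, k, rfl⟩
    rw [dist_comm, dist_eq_norm]
    exact hmod k s s.2 t t.2
  have hK := BoundedContinuousFunction.arzela_ascoli (Metric.closedBall (0 : E) R)
    (isCompact_closedBall 0 R) (range y) (by
      rintro _ t ⟨k, rfl⟩
      rw [mem_closedBall_zero_iff]
      exact hR k t t.2) heq
  obtain ⟨x, -, ns, hns, hlim⟩ := hK.tendsto_subseq (x := y) fun k => subset_closure ⟨k, rfl⟩
  refine ⟨IccExtend hT.le x, ns, hns, x.continuous.Icc_extend'.continuousOn, ?_⟩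
  rw [Metric.tendstoUniformlyOn_iff]
  intro ε hε
  filter_upwards [Metric.tendsto_nhds.1 hlim ε hε] with k hk t ht
  rw [IccExtend_of_mem _ _ ht, dist_comm]
  exact (BoundedContinuousFunction.dist_coe_le_dist (f := y (ns k)) (g := x) ⟨t, ht⟩).trans_lt hk

/-! ### Normal integrands and extended-real integrals. -/

/-- Superposition measurability of normal integrands. -/
theorem NormalIntegrand.aemeasurable_comp {X : Type*} [PseudoMetricSpace X]
    [SecondCountableTopology X] [MeasurableSpace X] [BorelSpace X] {T : ℝ} {f : ℝ → X → EReal}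
    (hf : NormalIntegrand T f) {z : ℝ → X} (hz : AEMeasurable z (timeMeasure T)) :
    AEMeasurable (fun t => f t (z t)) (timeMeasure T) := by
  suffices h : ∀ z : ℝ → X, Measurable z → AEMeasurable (fun t => f t (z t)) (timeMeasure T) by
    refine (h _ hz.measurable_mk).congr ?_
    filter_upwards [hz.ae_eq_mk] with t ht using by rw [ht]
  intro z hz
  have : Nonempty X := ⟨z 0⟩
  let D := TopologicalSpace.denseSeq (X × ℝ)
  have hD : DenseRange D := TopologicalSpace.denseRange_denseSeq _
  have hreal : ∀ r : ℝ, NullMeasurableSet {t | f t (z t) ≤ (r : EReal)} (timeMeasure T) := by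
    intro r
    -- The epigraph is closed, so `(z t, r)` belongs to it iff at every scale some point of the
    -- dense sequence is close both to `(z t, r)` and to the epigraph.
    let A : Set ℝ := ⋂ j : ℕ, ⋃ i : ℕ, {t | dist (D i) (z t, r) < 1 / ((j : ℝ) + 1)} ∩
      {t | t ∈ Icc 0 T ∧ (epigraph (f t) ∩ Metric.ball (D i) (1 / ((j : ℝ) + 1))).Nonempty}
    have hA : NullMeasurableSet A (timeMeasure T) := by
      refine NullMeasurableSet.iInter fun j => NullMeasurableSet.iUnion fun i => ?_
      refine NullMeasurableSet.inter ?_ ?_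
      · exact (measurableSet_lt (measurable_const.dist (hz.prodMk measurable_const))
          measurable_const).nullMeasurableSet
      · exact (hf.2 _ Metric.isOpen_ball).mono_ac Measure.absolutelyContinuous_restrict
    refine hA.congr ?_
    filter_upwards [ae_restrict_mem measurableSet_Icc] with t ht
    refine propext ?_
    change t ∈ A ↔ (z t, r) ∈ epigraph (f t)
    simp only [A, mem_iInter, mem_iUnion, mem_inter_iff]
    constructor
    · intro h
      rw [← (hf.1 t ht).closure_eq]
      refine Metric.mem_closure_iff.2 fun ε hε => ?_
      obtain ⟨j, hj⟩ := exists_nat_one_div_lt (half_pos hε)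
      obtain ⟨i, h1, -, p, hp, hpD⟩ := h j
      refine ⟨p, hp, ?_⟩
      have h1' : dist (D i) (z t, r) < 1 / ((j : ℝ) + 1) := h1
      have h2 := dist_triangle (z t, r) (D i) p
      rw [dist_comm _ (D i), dist_comm (D i) p] at h2
      have := Metric.mem_ball.1 hpD
      linarith
    · intro h j
      obtain ⟨i, hi⟩ := hD.exists_dist_lt (z t, r) (show (0 : ℝ) < 1 / ((j : ℝ) + 1) by positivity)
      refine ⟨i, ?_, ht, (z t, r), h, Metric.mem_ball.2 hi⟩
      rw [dist_comm] at hi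
      exact hi
  have hnull : NullMeasurable (fun t => f t (z t)) (timeMeasure T) := by
    refine @measurable_of_Iic EReal (NullMeasurableSpace ℝ (timeMeasure T)) _ _ _ _ _ _ _ _ ?_
    intro c
    change NullMeasurableSet {t | f t (z t) ≤ c} (timeMeasure T)
    induction c with
    | top => simp
    | coe r => exact hreal r
    | bot =>
      have : {t | f t (z t) ≤ ⊥} = ⋂ k : ℕ, {t | f t (z t) ≤ ((-(k : ℝ) : ℝ) : EReal)} := by
        ext t
        simp only [mem_iInter, mem_ofPred_eq]
        refine ⟨fun h k => h.trans bot_le, fun h => ?_⟩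
        refine le_of_eq (EReal.eq_bot_iff_forall_lt _ |>.2 fun y => ?_)
        obtain ⟨k, hk⟩ := exists_nat_gt (-y)
        refine (h k).trans_lt ?_
        exact_mod_cast (by linarith : -(k : ℝ) < y)
      rw [this]
      exact NullMeasurableSet.iInter fun k => hreal _
  exact hnull.aemeasurable

/-- The identity `y⁺ + a = (y + a)⁺ + y⁻` for `y ≥ -a`, kept additive so that it can be integrated
in `ENNReal` without truncated subtraction. -/
theorem toENNReal_add_ofReal_abs {y : EReal} {a : ℝ} (h : ((-a : ℝ) : EReal) ≤ y) (ha : 0 ≤ a) :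
    y.toENNReal + ENNReal.ofReal a = (y + (a : EReal)).toENNReal + (-y).toENNReal := by
  induction y with
  | bot => simp at h
  | top => simp
  | coe r =>
    have h' : -a ≤ r := by exact_mod_cast h
    rw [← EReal.coe_neg, ← EReal.coe_add]
    simp only [EReal.toENNReal_of_ne_top (EReal.coe_ne_top _), EReal.toReal_coe]
    rcases le_total 0 r with hr | hr
    · rw [ENNReal.ofReal_of_nonpos (by linarith : -r ≤ 0), add_zero, ENNReal.ofReal_add hr ha]
    · rw [ENNReal.ofReal_of_nonpos hr, zero_add, ← ENNReal.ofReal_add (by linarith) (by linarith)]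
      congr 1; ring

theorem coe_sub_coe_eq_of_add_eq {P Q R : ENNReal} {I : ℝ} (hI0 : 0 ≤ I)
    (hR : R ≤ ENNReal.ofReal I) (hsum : P + ENNReal.ofReal I = Q + R) :
    (P : EReal) - (R : EReal) = (Q : EReal) - (I : EReal) := by
  lift R to NNReal using (hR.trans_lt ENNReal.ofReal_lt_top).ne
  by_cases hP : P = ⊤
  · have hQ : Q = ⊤ := by
      by_contra hQ
      rw [hP, top_add] at hsum
      exact (ENNReal.add_ne_top.2 ⟨hQ, ENNReal.coe_ne_top⟩) hsum.symm
    rw [hP, hQ]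
    rfl
  · have hQ : Q ≠ ⊤ := by
      intro hQ
      rw [hQ, top_add] at hsum
      exact (ENNReal.add_ne_top.2 ⟨hP, ENNReal.ofReal_ne_top⟩) hsum
    lift P to NNReal using hP
    lift Q to NNReal using hQ
    have h1 := congrArg ENNReal.toReal hsum
    rw [ENNReal.toReal_add ENNReal.coe_ne_top ENNReal.ofReal_ne_top,
      ENNReal.toReal_add ENNReal.coe_ne_top ENNReal.coe_ne_top, ENNReal.toReal_ofReal hI0] at h1
    simp only [ENNReal.coe_toReal] at h1
    have h2 : ((P : ℝ) - R) = (Q : ℝ) - I := by linarith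
    change ((P : ℝ) : EReal) - ((R : ℝ) : EReal) = ((Q : ℝ) : EReal) - (I : EReal)
    rw [← EReal.coe_sub, ← EReal.coe_sub, h2]

/-- The extended integral of a function with an integrable minorant. -/
theorem integralEReal_eq_sub {T : ℝ} {f : ℝ → EReal} (hf : AEMeasurable f (timeMeasure T))
    {η : ℝ → ℝ} (hη : IntegrableOn η (Icc 0 T)) (hη0 : ∀ t, 0 ≤ η t)
    (h : ∀ᵐ t ∂(timeMeasure T), ((-η t : ℝ) : EReal) ≤ f t) :
    integralEReal T f = ((∫⁻ t in Icc 0 T, (f t + (η t : EReal)).toENNReal : ENNReal) : EReal) -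
      ((∫ t in Icc 0 T, η t : ℝ) : EReal) := by
  have hA : ∫⁻ t in Icc 0 T, ENNReal.ofReal (η t) = ENNReal.ofReal (∫ t in Icc 0 T, η t) :=
    (ofReal_integral_eq_lintegral_ofReal hη (ae_of_all _ hη0)).symm
  have hI0 : 0 ≤ ∫ t in Icc 0 T, η t := integral_nonneg hη0
  have hsum : (∫⁻ t in Icc 0 T, (f t).toENNReal) + ENNReal.ofReal (∫ t in Icc 0 T, η t) =
      (∫⁻ t in Icc 0 T, (f t + (η t : EReal)).toENNReal) + ∫⁻ t in Icc 0 T, (-f t).toENNReal := by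
    have hneg' : AEMeasurable (fun t => (-f t).toENNReal) (timeMeasure T) :=
      measurable_ereal_toENNReal.comp_aemeasurable hf.neg
    have hpos' : AEMeasurable (fun t => (f t).toENNReal) (timeMeasure T) :=
      measurable_ereal_toENNReal.comp_aemeasurable hf
    rw [← hA, ← lintegral_add_left' hpos',
      ← lintegral_add_right' _ hneg']
    refine lintegral_congr_ae ?_
    filter_upwards [h] with t ht using toENNReal_add_ofReal_abs ht (hη0 t)
  have hneg : ∫⁻ t in Icc 0 T, (-f t).toENNReal ≤ ENNReal.ofReal (∫ t in Icc 0 T, η t) := by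
    rw [← hA]
    refine lintegral_mono_ae ?_
    filter_upwards [h] with t ht
    have h1 : -f t ≤ (η t : EReal) := by
      rw [EReal.neg_le]
      simpa using ht
    have h2 := EReal.toENNReal_le_toENNReal h1
    rwa [EReal.toENNReal_of_ne_top (EReal.coe_ne_top _), EReal.toReal_coe] at h2
  exact coe_sub_coe_eq_of_add_eq hI0 hneg hsum

/-! ### Lower semicontinuity of the integral cost. -/

/-- Closed convex functions that are bounded below on a closed convex set have, on this set, affine
minorants that are nearly exact at a given point. -/
theorem exists_affine_minorant {E : Type*} [NormedAddCommGroup E] [NormedSpace ℝ E] {K : Set E}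
    (hK : IsClosed K) (hKc : Convex ℝ K) {f : E → EReal} (hf : IsClosed (epigraph f))
    (hfc : ConvexEReal f) {η : ℝ} (hη : ∀ p ∈ K, (η : EReal) ≤ f p) {q : E} {c : ℝ}
    (hc : (c : EReal) < f q) :
    ∃ (ξ : E →L[ℝ] ℝ) (β : ℝ), (∀ p ∈ K, ((ξ p + β : ℝ) : EReal) ≤ f p) ∧ c < ξ q + β := by
  let S : Set (E × ℝ) := epigraph f ∩ K ×ˢ univ
  have hS : Convex ℝ S := hfc.inter (hKc.prod convex_univ)
  have hScl : IsClosed S := hf.inter (hK.prod isClosed_univ)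
  have hmem : ∀ p ∈ K, ∀ r : ℝ, f p ≤ r → (p, r) ∈ S := fun p hp r hr => ⟨hr, hp, mem_univ _⟩
  have hnot : (q, c) ∉ S := fun h => (not_le.2 hc) h.1
  obtain ⟨Λ, v, hv, hvq⟩ := geometric_hahn_banach_closed_point hS hScl hnot
  let ξ : E →L[ℝ] ℝ := Λ.comp (ContinuousLinearMap.inl ℝ E ℝ)
  set b : ℝ := Λ (0, 1) with hb
  have hΛ : ∀ p r, Λ (p, r) = ξ p + b * r := by
    intro p r
    have : ((p, r) : E × ℝ) = (p, 0) + r • (0, 1) := by simp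
    rw [this, map_add, map_smul, smul_eq_mul, mul_comm]
    rfl
  rw [hΛ] at hvq
  by_cases hne : ∃ p ∈ K, f p ≠ ⊤
  · obtain ⟨p₁, hp₁, hfp₁⟩ := hne
    obtain ⟨r₁, hr₁⟩ : ∃ r : ℝ, f p₁ ≤ r := ⟨_, EReal.le_coe_toReal hfp₁⟩
    -- Epigraphs are unbounded upwards, so the separating functional cannot increase in the vertical
    -- direction.
    have hb0 : b ≤ 0 := by
      by_contra hb0
      push Not at hb0
      have h1 := hv _ (hmem p₁ hp₁ (max r₁ ((v - ξ p₁) / b))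
        (hr₁.trans (by exact_mod_cast le_max_left _ _)))
      rw [hΛ] at h1
      have h2 : b * ((v - ξ p₁) / b) ≤ b * max r₁ ((v - ξ p₁) / b) :=
        mul_le_mul_of_nonneg_left (le_max_right _ _) hb0.le
      rw [mul_div_cancel₀ _ hb0.ne'] at h2
      linarith
    rcases hb0.lt_or_eq with hb0 | hb0
    · refine ⟨-(b⁻¹) • ξ, v / b, fun p hp => ?_, ?_⟩
      · refine EReal.le_of_forall_lt_iff_le.1 fun r hr => ?_
        have h1 := hv _ (hmem p hp r hr.le)
        rw [hΛ] at h1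
        have h2 : (-(b⁻¹) • ξ) p + v / b = (v - ξ p) / b := by
          simp only [smul_apply, smul_eq_mul]; ring
        rw [h2]
        exact_mod_cast (div_le_iff_of_neg hb0).2 (by linarith)
      · have h2 : (-(b⁻¹) • ξ) q + v / b = (v - ξ q) / b := by
          simp only [smul_apply, smul_eq_mul]; ring
        rw [h2, lt_div_iff_of_neg hb0]
        linarith
    -- Vertical hyperplane: it separates `q` from the points of `K` where `f` is finite. A steep
    -- multiple of it added to the constant minorant `η` stays below `f` on `K`; `M` makes the gain
    -- `M * δ` at `q` exceed `c - η`.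
    · rw [hb0, zero_mul, add_zero] at hvq
      set δ := ξ q - v with hδ
      have hδ0 : 0 < δ := by linarith
      set M := (|c - η| + 1) / δ with hM
      have hM0 : 0 ≤ M := by positivity
      refine ⟨M • ξ, η - M * v, fun p hp => ?_, ?_⟩
      · by_cases hfp : f p = ⊤
        · rw [hfp]; exact le_top
        · have h1 := hv _ (hmem p hp _ (EReal.le_coe_toReal hfp))
          rw [hΛ, hb0, zero_mul, add_zero] at h1
          refine le_trans ?_ (hη p hp)
          have : M * (ξ p - v) ≤ 0 := mul_nonpos_of_nonneg_of_nonpos hM0 (by linarith)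
          simp only [smul_apply, smul_eq_mul]
          exact_mod_cast (by linarith : M * ξ p + (η - M * v) ≤ η)
      · have h1 : M * δ = |c - η| + 1 := by rw [hM]; field_simp
        simp only [smul_apply, smul_eq_mul]
        have := le_abs_self (c - η)
        rw [hδ] at h1
        linarith
  · push Not at hne
    refine ⟨0, c + 1, fun p hp => ?_, by simp⟩
    rw [hne p hp]
    exact le_top

/-- Lower closure: values at convex combinations of tails, with bounded convexified arguments and
convergent parameters. -/
theorem le_liminf_sum_of_tailWeights {X E : Type*} [PseudoMetricSpace X] [NormedAddCommGroup E]
    [NormedSpace ℝ E] [ProperSpace E] {f : X × E → EReal} (hf : IsClosed (epigraph f))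
    {K : Set E} (hK : IsClosed K) (hKc : Convex ℝ K) {A : ℝ}
    (hA : ∀ x, ∀ p ∈ K, ((-A : ℝ) : EReal) ≤ f (x, p)) {x : ℕ → X} {x₀ : X}
    (hfc : ConvexEReal fun p => f (x₀, p)) (hx : Tendsto x atTop (𝓝 x₀))
    {q : ℕ → E} {q₀ : E} (hqK : ∀ k, q k ∈ K) {B : ℝ} (hqB : ∀ k, ‖q k‖ ≤ B)
    {W : ℕ → Finset ℕ} {w : ℕ → ℕ → ℝ} (hW : IsTailWeights W w)
    (hq : Tendsto (fun N => ∑ k ∈ W N, w N k • q k) atTop (𝓝 q₀)) :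
    (f (x₀, q₀) + (A : EReal)).toENNReal ≤
      liminf (fun N => ∑ k ∈ W N, ENNReal.ofReal (w N k) * (f (x k, q k) + (A : EReal)).toENNReal)
        atTop := by
  refine le_of_forall_lt fun y hy => ?_
  obtain ⟨y', hyy', hy'⟩ := exists_between hy
  refine hyy'.trans_le ?_
  lift y' to NNReal using (hy'.trans_le le_top).ne
  have hcy : (((y' : ℝ) - A : ℝ) : EReal) < f (x₀, q₀) := by
    by_contra hcon
    push Not at hcon
    have h1 : f (x₀, q₀) + (A : EReal) ≤ ((y' : ℝ) : EReal) := by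
      have := add_le_add_left hcon (A : EReal)
      rwa [← EReal.coe_add, sub_add_cancel] at this
    have h2 := EReal.toENNReal_le_toENNReal h1
    refine (not_le.2 hy') (h2.trans_eq ?_)
    rw [EReal.toENNReal_of_ne_top (EReal.coe_ne_top _), EReal.toReal_coe, ENNReal.ofReal_coe_nnreal]
  have hsec : IsClosed (epigraph fun p => f (x₀, p)) :=
    hf.preimage (f := fun p : E × ℝ => ((x₀, p.1), p.2)) (by fun_prop)
  obtain ⟨ξ, β, hξ, hξq⟩ := exists_affine_minorant hK hKc hsec hfc (hA x₀) hcy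
  set ε := (ξ q₀ + β - (y' - A)) / 2 with hε
  have hε0 : 0 < ε := by rw [hε]; linarith
  -- The minorant at `x₀` holds up to `ε` along the original sequence: otherwise a convergent
  -- subsequence of the bounded `q k` and closedness of the epigraph would violate it at `x₀`. Being
  -- affine in `q k`, the inequality can then be averaged.
  have hev : ∀ᶠ k in atTop, ((ξ (q k) + β - ε : ℝ) : EReal) ≤ f (x k, q k) := by
    by_contra hcon
    have hfr : ∃ᶠ k in atTop, f (x k, q k) ≤ ((ξ (q k) + β - ε : ℝ) : EReal) := by
      refine (not_eventually.1 hcon).mono fun k hk => (not_le.1 hk).le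
    obtain ⟨ns, hns, hle⟩ := extraction_of_frequently_atTop hfr
    obtain ⟨p, -, ms, hms, hlim⟩ := (isCompact_closedBall (0 : E) B).tendsto_subseq
      (x := q ∘ ns) fun k => mem_closedBall_zero_iff.2 (hqB _)
    have hpK : p ∈ K := hK.mem_of_tendsto hlim (Eventually.of_forall fun k => hqK _)
    have hxlim := hx.comp (hns.tendsto_atTop.comp hms.tendsto_atTop)
    have h1 : ((x₀, p), ξ p + β - ε) ∈ epigraph f := by
      refine hf.mem_of_tendsto (b := atTop) (f := fun k =>
        ((x (ns (ms k)), q (ns (ms k))), ξ (q (ns (ms k))) + β - ε)) ?_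
        (Eventually.of_forall fun k => hle (ms k))
      refine (hxlim.prodMk_nhds hlim).prodMk_nhds ?_
      exact (((ξ.continuous.tendsto p).comp hlim).add_const β).sub_const ε
    have h2 := (hξ p hpK).trans h1
    have h3 : ξ p + β ≤ ξ p + β - ε := by exact_mod_cast h2
    linarith
  have hcomb : ∀ᶠ N in atTop, (y' : ℝ) - A < ξ (∑ k ∈ W N, w N k • q k) + β - ε := by
    have h1 := (((ξ.continuous.tendsto q₀).comp hq).add_const β).sub_const ε
    exact h1.eventually_const_lt (by rw [hε]; linarith)
  refine le_liminf_of_le (by isBoundedDefault) ?_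
  filter_upwards [hcomb, hW.eventually_forall hev] with N h1 h2
  calc (y' : ENNReal) = ENNReal.ofReal y' := (ENNReal.ofReal_coe_nnreal).symm
    _ ≤ ENNReal.ofReal (∑ k ∈ W N, w N k * (ξ (q k) + β - ε + A)) := by
      refine ENNReal.ofReal_le_ofReal ?_
      have e : ∑ k ∈ W N, w N k * (ξ (q k) + β - ε + A) =
          ξ (∑ k ∈ W N, w N k • q k) + (β - ε + A) := by
        rw [map_sum]
        simp only [map_smul, smul_eq_mul]
        calc ∑ k ∈ W N, w N k * (ξ (q k) + β - ε + A)
            = ∑ k ∈ W N, (w N k * ξ (q k) + w N k * (β - ε + A)) :=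
              Finset.sum_congr rfl fun k _ => by ring
          _ = _ := by rw [Finset.sum_add_distrib, ← Finset.sum_mul, (hW N).2, one_mul]
      rw [e]
      linarith
    _ ≤ ∑ k ∈ W N, ENNReal.ofReal (w N k * (ξ (q k) + β - ε + A)) := by
      exact Finset.le_sum_of_subadditive ENNReal.ofReal ENNReal.ofReal_zero.le
        (fun _ _ => ENNReal.ofReal_add_le) _ _
    _ ≤ _ := by
      refine Finset.sum_le_sum fun k hk => ?_
      rw [ENNReal.ofReal_mul ((hW N).1 k hk).2]
      gcongr
      have h3 : ((ξ (q k) + β - ε + A : ℝ) : EReal) ≤ f (x k, q k) + (A : EReal) := by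
        rw [EReal.coe_add]
        exact add_le_add_left (h2 k hk) _
      have h4 := EReal.toENNReal_le_toENNReal h3
      rwa [EReal.toENNReal_of_ne_top (EReal.coe_ne_top _), EReal.toReal_coe] at h4

/-- Adding `|η|` makes all integrands nonnegative. Fatou's lemma is applied to the convex
combinations of their values, whose integrals inherit the common bound because the weights sum to
one. -/
theorem integralEReal_le_of_eventually_le {n m : ℕ} {T : ℝ} {U : Set (Vec m)}
    {φ : ℝ → Vec n × Vec n × Vec m → EReal} (hUcl : IsClosed U) (hUc : Convex ℝ U)
    (hφ : NormalIntegrand T φ)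
    (hφconvex : ∀ s ∈ Icc 0 T, ∀ x : Vec n,
      ConvexEReal (fun q : Vec n × Vec m => φ s (x, q.1, q.2)))
    {η : ℝ → ℝ} (hη : IntegrableOn η (Icc 0 T))
    (hφη : ∀ s ∈ Icc 0 T, ∀ x y : Vec n, ∀ u ∈ U, (η s : EReal) ≤ φ s (x, y, u))
    {xk yk : ℕ → ℝ → Vec n} {uk : ℕ → ℝ → Vec m} {x y : ℝ → Vec n} {u : ℝ → Vec m}
    (hxm : ∀ k, AEMeasurable (xk k) (timeMeasure T))
    (hym : ∀ k, AEMeasurable (yk k) (timeMeasure T)) (huk : ∀ k, IsControl T U (uk k))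
    (hxm' : AEMeasurable x (timeMeasure T)) (hym' : AEMeasurable y (timeMeasure T))
    (hu : IsControl T U u)
    (hx : ∀ t ∈ Icc 0 T, Tendsto (fun k => xk k t) atTop (𝓝 (x t)))
    (hb : ∀ᵐ t ∂(timeMeasure T), ∃ B, ∀ k, ‖yk k t‖ ≤ B) (hUb : Bornology.IsBounded U)
    {W : ℕ → Finset ℕ} {w : ℕ → ℕ → ℝ} (hW : IsTailWeights W w)
    (hylim : ∀ᵐ t ∂(timeMeasure T),
      Tendsto (fun N => ∑ k ∈ W N, w N k • yk k t) atTop (𝓝 (y t)))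
    (hulim : ∀ᵐ t ∂(timeMeasure T),
      Tendsto (fun N => ∑ k ∈ W N, w N k • uk k t) atTop (𝓝 (u t)))
    {a : ℝ} (ha : ∀ᶠ k in atTop, integralEReal T (fun s => φ s (xk k s, yk k s, uk k s)) ≤ a) :
    integralEReal T (fun s => φ s (x s, y s, u s)) ≤ a := by
  have hmk : ∀ k, AEMeasurable (fun s => φ s (xk k s, yk k s, uk k s)) (timeMeasure T) := fun k =>
    hφ.aemeasurable_comp ((hxm k).prodMk ((hym k).prodMk (huk k).1))
  have hm : AEMeasurable (fun s => φ s (x s, y s, u s)) (timeMeasure T) :=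
    hφ.aemeasurable_comp (hxm'.prodMk (hym'.prodMk hu.1))
  have hlow : ∀ s ∈ Icc 0 T, ∀ x y : Vec n, ∀ u ∈ U, ((-|η s| : ℝ) : EReal) ≤ φ s (x, y, u) :=
    fun s hs x y u hu => le_trans (by exact_mod_cast neg_abs_le (η s)) (hφη s hs x y u hu)
  have hη' : IntegrableOn (fun t => |η t|) (Icc 0 T) := hη.abs
  have hη0 : ∀ t, 0 ≤ |η t| := fun t => abs_nonneg _
  have eqk : ∀ k, _ := fun k => integralEReal_eq_sub (hmk k) hη' hη0 (by
    filter_upwards [(huk k).2, ae_restrict_mem measurableSet_Icc] with t h1 ht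
      using hlow t ht _ _ _ h1)
  rw [integralEReal_eq_sub hm hη' hη0 (by
    filter_upwards [hu.2, ae_restrict_mem measurableSet_Icc] with t h1 ht using hlow t ht _ _ _ h1)]
  set I := ∫ t in Icc 0 T, |η t|
  let Θ : ℕ → ℝ → ENNReal := fun k t => (φ t (xk k t, yk k t, uk k t) + (|η t| : ℝ)).toENNReal
  have hΘm : ∀ k, AEMeasurable (Θ k) (timeMeasure T) := fun k =>
    measurable_ereal_toENNReal.comp_aemeasurable
      ((hmk k).add hη'.aestronglyMeasurable.aemeasurable.coe_real_ereal)
  have hev : ∀ᶠ k in atTop, ((∫⁻ t in Icc 0 T, Θ k t : ENNReal) : EReal) ≤ ((a + I : ℝ) : EReal) := by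
    filter_upwards [ha] with k hk
    rw [eqk k, EReal.sub_le_iff_le_add (Or.inl (EReal.coe_ne_bot _)) (Or.inl (EReal.coe_ne_top _))]
      at hk
    rwa [EReal.coe_add]
  have haI : 0 ≤ a + I := by
    obtain ⟨k, hk⟩ := hev.exists
    have : ((0 : ℝ) : EReal) ≤ ((a + I : ℝ) : EReal) := (EReal.coe_ennreal_nonneg _).trans hk
    exact_mod_cast this
  have hev' : ∀ᶠ k in atTop, ∫⁻ t in Icc 0 T, Θ k t ≤ ENNReal.ofReal (a + I) := by
    filter_upwards [hev] with k hk
    rw [← EReal.coe_ennreal_le_coe_ennreal_iff, EReal.coe_ennreal_ofReal, max_eq_left haI]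
    exact hk
  rw [EReal.sub_le_iff_le_add (Or.inl (EReal.coe_ne_bot _)) (Or.inl (EReal.coe_ne_top _)),
    ← EReal.coe_add]
  have hfin : ∫⁻ t in Icc 0 T, (φ t (x t, y t, u t) + (|η t| : ℝ)).toENNReal ≤
      ENNReal.ofReal (a + I) := by
    calc ∫⁻ t in Icc 0 T, (φ t (x t, y t, u t) + (|η t| : ℝ)).toENNReal
        ≤ ∫⁻ t in Icc 0 T, liminf (fun N => ∑ k ∈ W N, ENNReal.ofReal (w N k) * Θ k t) atTop := by
          refine lintegral_mono_ae ?_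
          obtain ⟨R, hR⟩ := hUb.exists_norm_le
          filter_upwards [hb, hylim, hulim, ae_all_iff.2 fun k => (huk k).2,
            ae_restrict_mem measurableSet_Icc] with t ⟨B, hB⟩ h1 h2 h3 ht
          refine le_liminf_sum_of_tailWeights (f := φ t) (hφ.1 t ht) (K := univ ×ˢ U)
            (isClosed_univ.prod hUcl) (convex_univ.prod hUc) (fun x p hp => hlow t ht x p.1 p.2 hp.2)
            (hφconvex t ht (x t)) (hx t ht) (q := fun k => (yk k t, uk k t)) (q₀ := (y t, u t))
            (fun k => ⟨mem_univ _, h3 k⟩) (B := max B R) (fun k => ?_) hW ?_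
          · exact norm_prod_le_iff.2 ⟨(hB k).trans (le_max_left _ _),
              (hR _ (h3 k)).trans (le_max_right _ _)⟩
          · refine (h1.prodMk_nhds h2).congr fun N => ?_
            ext1 <;> simp [Prod.fst_sum, Prod.snd_sum]
      _ ≤ liminf (fun N => ∫⁻ t in Icc 0 T, ∑ k ∈ W N, ENNReal.ofReal (w N k) * Θ k t) atTop :=
          lintegral_liminf_le' fun N =>
            Finset.aemeasurable_fun_sum _ fun k _ => (hΘm k).const_mul _
      _ ≤ ENNReal.ofReal (a + I) := by
          refine liminf_le_of_frequently_le' (Eventually.frequently ?_)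
          filter_upwards [hW.eventually_forall hev'] with N hN
          rw [lintegral_finsetSum' _ fun k _ => (hΘm k).const_mul _]
          calc ∑ k ∈ W N, ∫⁻ t in Icc 0 T, ENNReal.ofReal (w N k) * Θ k t
              ≤ ∑ k ∈ W N, ENNReal.ofReal (w N k) * ENNReal.ofReal (a + I) := by
                refine Finset.sum_le_sum fun k hk => ?_
                rw [lintegral_const_mul'' _ (hΘm k)]
                gcongr
                exact hN k hk
            _ = ENNReal.ofReal (a + I) := by
                rw [← Finset.sum_mul, ← ENNReal.ofReal_sum_of_nonneg fun k hk => ((hW N).1 k hk).2,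
                  (hW N).2, ENNReal.ofReal_one, one_mul]
  calc ((∫⁻ t in Icc 0 T, (φ t (x t, y t, u t) + (|η t| : ℝ)).toENNReal : ENNReal) : EReal)
      ≤ ((ENNReal.ofReal (a + I) : ENNReal) : EReal) :=
        EReal.coe_ennreal_le_coe_ennreal_iff.2 hfin
    _ = ((a + I : ℝ) : EReal) := by rw [EReal.coe_ennreal_ofReal, max_eq_left haI]

/-! ### Closure of the inclusion, a priori bounds and compactness of trajectories. -/

/-- Closed convex values and upper hemicontinuity are stable under convex combinations of tails. -/
theorem mem_of_tailWeights_of_upperHemicontinuous {E : Type*} [NormedAddCommGroup E]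
    [NormedSpace ℝ E] {X : Type*} [TopologicalSpace X] {F : X → Set E} (hF : UpperHemicontinuous F)
    {x : ℕ → X} {x₀ : X} (hcl : IsClosed (F x₀)) (hcv : Convex ℝ (F x₀))
    (hx : Tendsto x atTop (𝓝 x₀)) {q : ℕ → E} (hq : ∀ k, q k ∈ F (x k)) {q₀ : E}
    {W : ℕ → Finset ℕ} {w : ℕ → ℕ → ℝ} (hW : IsTailWeights W w)
    (hlim : Tendsto (fun N => ∑ k ∈ W N, w N k • q k) atTop (𝓝 q₀)) : q₀ ∈ F x₀ := by
  rw [← hcl.closure_eq, ← Metric.cthickening_zero, Metric.cthickening_eq_iInter_cthickening]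
  simp only [mem_iInter]
  intro ε hε
  have hnhds : Metric.thickening ε (F x₀) ∈ 𝓝ˢ (F x₀) :=
    Metric.isOpen_thickening.mem_nhdsSet.2 (Metric.self_subset_thickening hε _)
  have hev : ∀ᶠ k in atTop, Metric.thickening ε (F x₀) ∈ 𝓝ˢ (F (x k)) :=
    hx.eventually (upperHemicontinuousAt_iff.1 (hF x₀) _ hnhds)
  refine Metric.isClosed_cthickening.mem_of_tendsto hlim ?_
  filter_upwards [hW.eventually_forall hev] with N hN
  exact hW.sum_mem (hcv.cthickening ε) fun k hk =>
    Metric.thickening_subset_cthickening ε _ (subset_of_mem_nhdsSet (hN k hk) (hq k))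

theorem coeFn_sum_smul {α E : Type*} [MeasurableSpace α] {μ : Measure α} [NormedAddCommGroup E]
    [NormedSpace ℝ E] {p : ENNReal} (s : Finset ℕ) (w : ℕ → ℝ) (V : ℕ → Lp E p μ) :
    (∑ k ∈ s, w k • V k : Lp E p μ) =ᵐ[μ] fun t => ∑ k ∈ s, w k • V k t := by
  classical
  induction s using Finset.induction_on with
  | empty =>
    simp only [Finset.sum_empty]
    exact Lp.coeFn_zero E p μ
  | insert k s hk ih =>
    rw [Finset.sum_insert hk]
    filter_upwards [Lp.coeFn_add (w k • V k) (∑ k ∈ s, w k • V k), Lp.coeFn_smul (w k) (V k), ih]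
      with t h1 h2 h3
    rw [h1, Pi.add_apply, h2, h3, Finset.sum_insert hk, Pi.smul_apply]

section

variable {n m : ℕ} {T : ℝ} {U : Set (Vec m)} {F : ℝ → Vec n → Set (Vec n)}
  {g : ℝ → ℝ → Vec n → Vec m → Vec n} {C : Set (Vec n × Vec n)}

/-- A priori bounds for all solutions with bounded initial values. -/
theorem exists_apriori_bound (hT : 0 < T) (hU : Bornology.IsBounded U) (hUc : Convex ℝ U)
    (hne : U.Nonempty) (hF : HypF T F) (hg : ∀ u ∈ U, HypKernel T (fun t s x => g t s x u))
    (hG : NormWeakContinuous T U g) (R₀ : ℝ) :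
    ∃ (R : ℝ) (ψ : ℝ → ℝ), IntegrableOn ψ (Icc 0 T) ∧ (∀ t ∈ Icc 0 T, 1 ≤ ψ t) ∧
      ∀ x u, Feasible T F g U C x u → ‖x 0‖ ≤ R₀ → (∀ t ∈ Icc 0 T, ‖x t‖ ≤ R) ∧
        ∀ᵐ t ∂(timeMeasure T), ‖deriv x t‖ ≤ ψ t := by
  obtain ⟨S, hSi, hS0, hS⟩ := exists_integralMap_bound hU hUc hne hg hG
  obtain ⟨c, d, hc0, hd0, hci, hdi, hcd⟩ := hF.growth
  let a : ℝ → ℝ := fun t => c t + d t + S t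
  have hai : IntegrableOn a (Icc 0 T) := (hci.add hdi).add hSi
  have ha0 : ∀ t ∈ Icc 0 T, 0 ≤ a t := fun t ht =>
    add_nonneg (add_nonneg (hc0 t ht) (hd0 t ht)) (hS0 t ht)
  obtain ⟨N, hN⟩ := exists_nat_ge (2 * ∫ s in (0 : ℝ)..T, a s)
  let R : ℝ := 2 ^ N * (1 + |R₀|)
  have hR0 : 0 ≤ R := by positivity
  -- The summand `1` keeps the majorant away from zero, so that derivatives can later be divided by
  -- it.
  refine ⟨R, fun t => a t * (1 + R) + 1,
    (hai.mul_const _).add (integrableOn_const measure_Icc_lt_top.ne), fun t ht => ?_,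
    fun x u hxu hx0 => ?_⟩
  · have := mul_nonneg (ha0 t ht) (show 0 ≤ 1 + R by positivity)
    linarith
  have hder : ∀ᵐ t ∂(timeMeasure T), ∀ M, (∀ s ∈ Icc 0 t, ‖x s‖ ≤ M) →
      ‖deriv x t‖ ≤ a t * (1 + M) := by
    filter_upwards [hS, hcd, hxu.inclusion, ae_restrict_mem measurableSet_Icc]
      with t h1 h2 ⟨v, hv, hdv⟩ ht M hM
    have h3 := h1 x u (hxu.ac.continuousOn hT) hxu.control M hM
    have h4 := h2 _ v hv
    have h5 := hM t ⟨ht.1, le_rfl⟩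
    have hM0 : 0 ≤ M := (norm_nonneg _).trans h5
    have h6 := mul_le_mul_of_nonneg_left h5 (hc0 t ht)
    have h7 := mul_nonneg (hd0 t ht) hM0
    have h8 := hc0 t ht
    rw [hdv]
    calc ‖v + integralMap g x u t‖ ≤ ‖v‖ + ‖integralMap g x u t‖ := norm_add_le _ _
      _ ≤ (c t * M + d t) + S t * (1 + M) := by linarith
      _ ≤ (c t + d t + S t) * (1 + M) := by nlinarith
  have hbd : ∀ t ∈ Icc 0 T, ‖x t‖ ≤ R := fun t ht => by
    have h1 := hxu.ac.norm_le_of_norm_deriv_le hT hai ha0 hder (N := N) (by linarith) ht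
    have h2 : (2 : ℝ) ^ N * (1 + ‖x 0‖) ≤ R :=
      mul_le_mul_of_nonneg_left (by linarith [le_abs_self R₀]) (by positivity)
    linarith
  refine ⟨hbd, ?_⟩
  filter_upwards [hder, ae_restrict_mem measurableSet_Icc] with t h1 ht
  linarith [h1 R fun s hs => hbd s ⟨hs.1, hs.2.trans ht.2⟩]

theorem ae_tendsto_subseq_of_tendsto_Lp {α E : Type*} [MeasurableSpace α] {μ : Measure α}
    [NormedAddCommGroup E] [NormedSpace ℝ E] {W : ℕ → Finset ℕ} {w : ℕ → ℕ → ℝ}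
    {V : ℕ → Lp E 2 μ} {V₀ : Lp E 2 μ}
    (h : Tendsto (fun N => ∑ k ∈ W N, w N k • V k) atTop (𝓝 V₀)) :
    ∃ ns : ℕ → ℕ, StrictMono ns ∧ ∀ᵐ t ∂μ,
      Tendsto (fun N => ∑ k ∈ W (ns N), w (ns N) k • V k t) atTop (𝓝 (V₀ t)) := by
  obtain ⟨ns, hns, hlim⟩ := (tendstoInMeasure_of_tendsto_Lp h).exists_seq_tendsto_ae
  refine ⟨ns, hns, ?_⟩
  filter_upwards [hlim, ae_all_iff.2 fun N => coeFn_sum_smul (W (ns N)) (w (ns N)) V]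
    with t h1 h2
  exact h1.congr fun N => h2 N

/-- Compactness of families of trajectories with dominated derivatives. -/
theorem exists_limit_pair (hT : 0 < T) (hU : Bornology.IsBounded U) (hUcl : IsClosed U)
    (hUc : Convex ℝ U) {xk : ℕ → ℝ → Vec n} {uk : ℕ → ℝ → Vec m} (hac : ∀ k, IsAC T (xk k))
    (hctl : ∀ k, IsControl T U (uk k)) {R : ℝ} (hR : ∀ k, ∀ t ∈ Icc 0 T, ‖xk k t‖ ≤ R)
    {ψ : ℝ → ℝ} (hψ : IntegrableOn ψ (Icc 0 T)) (hψ1 : ∀ t ∈ Icc 0 T, 1 ≤ ψ t)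
    (hd : ∀ k, ∀ᵐ t ∂(timeMeasure T), ‖deriv (xk k) t‖ ≤ ψ t) :
    ∃ (x : ℝ → Vec n) (u : ℝ → Vec m) (ns : ℕ → ℕ) (W : ℕ → Finset ℕ) (w : ℕ → ℕ → ℝ),
      StrictMono ns ∧ IsAC T x ∧ IsControl T U u ∧
      TendstoUniformlyOn (fun k => xk (ns k)) x atTop (Icc 0 T) ∧
      WeakL2Tendsto T (fun k => uk (ns k)) u ∧ IsTailWeights W w ∧
      (∀ᵐ t ∂(timeMeasure T),
        Tendsto (fun N => ∑ k ∈ W N, w N k • deriv (xk (ns k)) t) atTop (𝓝 (deriv x t))) ∧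
      ∀ᵐ t ∂(timeMeasure T),
        Tendsto (fun N => ∑ k ∈ W N, w N k • uk (ns k) t) atTop (𝓝 (u t)) := by
  have hψi : ∀ s ∈ Icc 0 T, ∀ t ∈ Icc 0 T, IntervalIntegrable ψ volume s t := fun s hs t ht =>
    (hψ.mono_set (uIcc_subset_Icc hs ht)).intervalIntegrable
  have h0m : (0 : ℝ) ∈ Icc 0 T := left_mem_Icc.2 hT.le
  -- uniform convergence of the trajectories
  have hmod : ∀ k, ∀ s ∈ Icc 0 T, ∀ t ∈ Icc 0 T, ‖xk k t - xk k s‖ ≤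
      |(∫ r in (0 : ℝ)..t, ψ r) - ∫ r in (0 : ℝ)..s, ψ r| := by
    have hle : ∀ k, ∀ s ∈ Icc 0 T, ∀ t ∈ Icc 0 T, s ≤ t → ‖xk k t - xk k s‖ ≤
        |(∫ r in (0 : ℝ)..t, ψ r) - ∫ r in (0 : ℝ)..s, ψ r| := by
      intro k s hs t ht hst
      rw [intervalIntegral.integral_interval_sub_left (hψi 0 h0m t ht) (hψi 0 h0m s hs)]
      refine ((hac k).norm_sub_le hT hs ht hst hψ ?_).trans (le_abs_self _)
      filter_upwards [(ae_restrict_iff' measurableSet_Icc).1 (hd k)] with r hr hrm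
      exact hr ⟨hs.1.trans hrm.1.le, hrm.2.trans ht.2⟩
    intro k s hs t ht
    rcases le_total s t with hst | hst
    · exact hle k s hs t ht hst
    · rw [norm_sub_rev, abs_sub_comm]
      exact hle k t ht s hs hst
  obtain ⟨x, n₁, hn₁, hxc, hxu⟩ := exists_subseq_tendstoUniformlyOn hT hR
    (continuousOn_integral_of_integrableOn hT hψ) hmod
  -- weak compactness of the normalized derivatives and of the controls
  have hvm : ∀ k, AEStronglyMeasurable (fun t => (ψ t)⁻¹ • deriv (xk k) t) (timeMeasure T) :=
    fun k => (hψ.aestronglyMeasurable.aemeasurable.inv.aestronglyMeasurable).smul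
      ((hac k).integrableOn_deriv hT).aestronglyMeasurable
  have hvb : ∀ k, ∀ᵐ t ∂(timeMeasure T), ‖(ψ t)⁻¹ • deriv (xk k) t‖ ≤ 1 := by
    intro k
    filter_upwards [hd k, ae_restrict_mem measurableSet_Icc] with t h1 ht
    have h2 : 0 < ψ t := zero_lt_one.trans_le (hψ1 t ht)
    rw [norm_smul, norm_inv, Real.norm_of_nonneg h2.le, inv_mul_le_one₀ h2]
    exact h1
  have hvL : ∀ k, MemLp (fun t => (ψ t)⁻¹ • deriv (xk k) t) 2 (timeMeasure T) := fun k =>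
    MemLp.of_bound (hvm k) 1 (hvb k)
  let V : ℕ → Lp (Vec n) 2 (timeMeasure T) := fun k => (hvL k).toLp _
  let Y : ℕ → Lp (Vec m) 2 (timeMeasure T) := fun k => ((hctl k).memLp hU 2).toLp _
  obtain ⟨RU, hRU⟩ := hU.exists_norm_le
  have hRU' : ∀ k, ∀ᵐ t ∂(timeMeasure T), ‖uk k t‖ ≤ max RU 0 := fun k =>
    (hctl k).2.mono fun t ht => (hRU _ ht).trans (le_max_left _ _)
  have : Fact ((2 : ENNReal) ≠ ⊤) := ⟨by norm_num⟩
  obtain ⟨V₀, n₂, hn₂, hV⟩ := exists_subseq_weak_tendsto (z := fun k => V (n₁ k)) (fun k =>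
    Lp.norm_le_of_ae_bound zero_le_one (f := V (n₁ k)) (by
      filter_upwards [(hvL (n₁ k)).coeFn_toLp, hvb (n₁ k)] with t h1 h2
      rw [h1]
      exact h2))
  obtain ⟨Y₀, n₃, hn₃, hY⟩ := exists_subseq_weak_tendsto (z := fun k => Y (n₁ (n₂ k))) (fun k =>
    Lp.norm_le_of_ae_bound (le_max_right RU 0) (f := Y (n₁ (n₂ k))) (by
      filter_upwards [((hctl (n₁ (n₂ k))).memLp hU 2).coeFn_toLp, hRU' (n₁ (n₂ k))] with t h1 h2
      rw [h1]
      exact h2))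
  let ns : ℕ → ℕ := fun k => n₁ (n₂ (n₃ k))
  have hns : StrictMono ns := hn₁.comp (hn₂.comp hn₃)
  have hVw : ∀ h, Tendsto (fun k => inner ℝ (V (ns k)) h) atTop (𝓝 (inner ℝ V₀ h)) := fun h =>
    (hV h).comp hn₃.tendsto_atTop
  have hxu' : TendstoUniformlyOn (fun k => xk (ns k)) x atTop (Icc 0 T) := fun s hs =>
    (hn₂.comp hn₃).tendsto_atTop.eventually (hxu s hs)
  -- strong convergence of convex combinations
  have hweak : ∀ f : Lp (Vec n) 2 (timeMeasure T) × Lp (Vec m) 2 (timeMeasure T) →L[ℝ] ℝ,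
      Tendsto (fun k => f (V (ns k), Y (ns k))) atTop (𝓝 (f (V₀, Y₀))) := by
    intro f
    let f₁ := f.comp (ContinuousLinearMap.inl ℝ _ _)
    let f₂ := f.comp (ContinuousLinearMap.inr ℝ _ _)
    have hsplit : ∀ v y, f (v, y) = f₁ v + f₂ y := by
      intro v y
      change f (v, y) = f (v, 0) + f (0, y)
      rw [← map_add, Prod.mk_add_mk, add_zero, zero_add]
    have hf₁ : ∀ v, f₁ v = inner ℝ v ((InnerProductSpace.toDual ℝ _).symm f₁) := fun v => by
      rw [real_inner_comm, InnerProductSpace.toDual_symm_apply]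
    have hf₂ : ∀ v, f₂ v = inner ℝ v ((InnerProductSpace.toDual ℝ _).symm f₂) := fun v => by
      rw [real_inner_comm, InnerProductSpace.toDual_symm_apply]
    simp only [hsplit, hf₁, hf₂]
    exact (hVw _).add (hY _)
  obtain ⟨W, w, hW, hlim⟩ := exists_tailWeights_of_weak_tendsto hweak
  have hlimV : Tendsto (fun N => ∑ k ∈ W N, w N k • V (ns k)) atTop (𝓝 V₀) := by
    refine ((continuous_fst.tendsto _).comp hlim).congr fun N => ?_
    simp [Prod.fst_sum]
  have hlimY : Tendsto (fun N => ∑ k ∈ W N, w N k • Y (ns k)) atTop (𝓝 Y₀) := by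
    refine ((continuous_snd.tendsto _).comp hlim).congr fun N => ?_
    simp [Prod.snd_sum]
  -- Subsequences are taken of the weight families only; the sequence being averaged is unchanged.
  obtain ⟨m₁, hm₁, haeV⟩ := ae_tendsto_subseq_of_tendsto_Lp hlimV
  obtain ⟨m₂, hm₂, haeY⟩ := ae_tendsto_subseq_of_tendsto_Lp
    (W := W ∘ m₁) (w := w ∘ m₁) (V := fun k => Y (ns k)) (hlimY.comp hm₁.tendsto_atTop)
  let W' : ℕ → Finset ℕ := (W ∘ m₁) ∘ m₂
  let w' : ℕ → ℕ → ℝ := (w ∘ m₁) ∘ m₂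
  have hW' : IsTailWeights W' w' := (hW.comp hm₁).comp hm₂
  have haeV' : ∀ᵐ t ∂(timeMeasure T), Tendsto (fun N => ∑ k ∈ W' N, w' N k • V (ns k) t) atTop
      (𝓝 (V₀ t)) := haeV.mono fun t ht => ht.comp hm₂.tendsto_atTop
  have hYeq : ∀ᵐ t ∂(timeMeasure T), ∀ k, Y (ns k) t = uk (ns k) t :=
    ae_all_iff.2 fun k => ((hctl (ns k)).memLp hU 2).coeFn_toLp
  have hVeq : ∀ᵐ t ∂(timeMeasure T), ∀ k, V (ns k) t = (ψ t)⁻¹ • deriv (xk (ns k)) t :=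
    ae_all_iff.2 fun k => (hvL (ns k)).coeFn_toLp
  have hulim : ∀ᵐ t ∂(timeMeasure T),
      Tendsto (fun N => ∑ k ∈ W' N, w' N k • uk (ns k) t) atTop (𝓝 (Y₀ t)) := by
    filter_upwards [haeY, hYeq] with t h1 h2
    simp only [h2] at h1
    exact h1
  have hu₀ : IsControl T U Y₀ := by
    refine ⟨(Lp.aestronglyMeasurable Y₀).aemeasurable, ?_⟩
    filter_upwards [hulim, ae_all_iff.2 fun k => (hctl (ns k)).2] with t h1 h2
    exact hUcl.mem_of_tendsto h1 (Eventually.of_forall fun N => hW'.sum_mem hUc fun k _ => h2 k)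
  let f : ℝ → Vec n := fun t => ψ t • V₀ t
  have hflim : ∀ᵐ t ∂(timeMeasure T),
      Tendsto (fun N => ∑ k ∈ W' N, w' N k • deriv (xk (ns k)) t) atTop (𝓝 (f t)) := by
    filter_upwards [haeV', hVeq, ae_restrict_mem measurableSet_Icc] with t h1 h2 ht
    have h3 : ψ t ≠ 0 := (zero_lt_one.trans_le (hψ1 t ht)).ne'
    refine (h1.const_smul (ψ t)).congr fun N => ?_
    rw [Finset.smul_sum]
    refine Finset.sum_congr rfl fun k _ => ?_
    rw [h2, smul_comm, smul_inv_smul₀ h3]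
  have hdall : ∀ᵐ t ∂(timeMeasure T), ∀ k, ‖deriv (xk (ns k)) t‖ ≤ ψ t :=
    ae_all_iff.2 fun k => hd (ns k)
  have hcomb : ∀ᵐ t ∂(timeMeasure T), ∀ N, ‖∑ k ∈ W' N, w' N k • deriv (xk (ns k)) t‖ ≤ ψ t := by
    filter_upwards [hdall] with t h1 N
    exact mem_closedBall_zero_iff.1 (hW'.sum_mem (convex_closedBall (0 : Vec n) (ψ t))
      fun k _ => mem_closedBall_zero_iff.2 (h1 k))
  have hfi : IntegrableOn f (Icc 0 T) := by
    refine Integrable.mono' hψ (hψ.aestronglyMeasurable.smul (Lp.aestronglyMeasurable V₀)) ?_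
    filter_upwards [hflim, hcomb] with t h1 h2
    exact le_of_tendsto h1.norm (Eventually.of_forall h2)
  have hxint : ∀ t ∈ Icc 0 T, x t = x 0 + ∫ s in (0 : ℝ)..t, f s := by
    intro t ht
    have h1 := hW'.tendsto (hxu'.tendsto_at ht)
    have h2 := hW'.tendsto (hxu'.tendsto_at h0m)
    have h3 : Tendsto (fun N => ∫ s in (0 : ℝ)..t, ∑ k ∈ W' N, w' N k • deriv (xk (ns k)) s) atTop
        (𝓝 (∫ s in (0 : ℝ)..t, f s)) := by
      have hsub : uIoc 0 t ⊆ Icc 0 T := fun s hs => by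
        rw [uIoc_of_le ht.1] at hs
        exact ⟨hs.1.le, hs.2.trans ht.2⟩
      refine intervalIntegral.tendsto_integral_filter_of_dominated_convergence ψ
        (Eventually.of_forall fun N => ?_) (Eventually.of_forall fun N => ?_) (hψi 0 h0m t ht) ?_
      · refine Finset.aestronglyMeasurable_fun_sum _ fun k _ => ?_
        exact (((hac (ns k)).integrableOn_deriv hT).mono_set hsub).aestronglyMeasurable.const_smul
          (w' N k)
      · filter_upwards [(ae_restrict_iff' measurableSet_Icc).1 hcomb] with s hs hsm
          using hs (hsub hsm) N
      · filter_upwards [(ae_restrict_iff' measurableSet_Icc).1 hflim] with s hs hsm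
          using hs (hsub hsm)
    -- The averaged trajectories still converge to `x`, and they are the integrals of the averaged
    -- derivatives, which converge by domination; hence `f` is the derivative of `x`.
    refine tendsto_nhds_unique h1 ((h2.add h3).congr fun N => ?_)
    have hdi : ∀ k, IntervalIntegrable (deriv (xk k)) volume 0 t := fun k =>
      (((hac k).integrableOn_deriv hT).mono_set (uIcc_subset_Icc h0m ht)).intervalIntegrable
    have hsi : ∀ k ∈ W' N, IntervalIntegrable (fun s => w' N k • deriv (xk (ns k)) s) volume 0 t :=
      fun k _ => (hdi (ns k)).smul (w' N k)
    rw [intervalIntegral.integral_finsetSum hsi, ← Finset.sum_add_distrib]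
    refine Finset.sum_congr rfl fun k _ => ?_
    rw [intervalIntegral.integral_smul, ← (hac (ns k)).sub_eq_integral hT h0m ht]
    module
  refine ⟨x, Y₀, ns, W', w', hns, ⟨x 0, f, hfi, hxint⟩, hu₀, hxu', ⟨fun k => (hctl _).memLp hU 2,
    Lp.memLp Y₀, fun θ hθ => ?_⟩, hW', ?_, hulim⟩
  · have h1 := hY (hθ.toLp θ)
    simp only [L2.inner_def] at h1
    have e1 : ∀ k, ∫ t in Icc 0 T, inner ℝ (Y (ns k) t) (hθ.toLp θ t) =
        ∫ t in Icc 0 T, inner ℝ (uk (ns k) t) (θ t) := by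
      intro k
      refine integral_congr_ae ?_
      filter_upwards [hYeq, hθ.coeFn_toLp] with t h2 h3
      rw [h2, h3]
    have e2 : ∫ t in Icc 0 T, inner ℝ (Y₀ t) (hθ.toLp θ t) = ∫ t in Icc 0 T, inner ℝ (Y₀ t) (θ t) := by
      refine integral_congr_ae ?_
      filter_upwards [hθ.coeFn_toLp] with t h3
      rw [h3]
    rw [← e2]
    exact h1.congr e1
  · filter_upwards [hflim, ae_deriv_eq_of_eq_integral hT hfi hxint] with t h1 h2
    rw [h2]
    exact h1

end

end IntegroDiff

end

/-! ### Existence of an optimal pair. -/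

theorem theorem6p1 {n m : ℕ} (T : ℝ) (hT : 0 < T)
    (F : ℝ → IntegroDiff.Vec n → Set (IntegroDiff.Vec n))
    (g : ℝ → ℝ → IntegroDiff.Vec n → IntegroDiff.Vec m → IntegroDiff.Vec n)
    (U : Set (IntegroDiff.Vec m)) (C : Set (IntegroDiff.Vec n × IntegroDiff.Vec n))
    (l : IntegroDiff.Vec n × IntegroDiff.Vec n → EReal)
    (φ : ℝ → IntegroDiff.Vec n × IntegroDiff.Vec n × IntegroDiff.Vec m → EReal)
    (hUbdd : Bornology.IsBounded U) (hUclosed : IsClosed U) (hUconvex : Convex ℝ U)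
    (hC : IsCompact C)
    (hF : IntegroDiff.HypF T F)
    (hg : ∀ u ∈ U, IntegroDiff.HypKernel T (fun t s x => g t s x u))
    (hG : IntegroDiff.NormWeakContinuous T U g)
    (hl : LowerSemicontinuous l)
    (hφ : IntegroDiff.NormalIntegrand T φ)
    (hφconvex : ∀ s ∈ Set.Icc 0 T, ∀ x : IntegroDiff.Vec n,
      IntegroDiff.ConvexEReal
        (fun q : IntegroDiff.Vec n × IntegroDiff.Vec m => φ s (x, q.1, q.2)))
    (hφbelow : ∃ η : ℝ → ℝ, MeasureTheory.IntegrableOn η (Set.Icc 0 T) ∧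
      ∀ s ∈ Set.Icc 0 T, ∀ x y : IntegroDiff.Vec n, ∀ u ∈ U, (η s : EReal) ≤ φ s (x, y, u))
    (hvalue_bot : IntegroDiff.value T F g U C l φ ≠ ⊥)
    (hvalue_top : IntegroDiff.value T F g U C l φ ≠ ⊤) :
    ∃ (x : ℝ → IntegroDiff.Vec n) (u : ℝ → IntegroDiff.Vec m),
      IntegroDiff.Feasible T F g U C x u ∧
        IntegroDiff.cost T l φ x u = IntegroDiff.value T F g U C l φ := by
  open IntegroDiff in
  obtain ⟨η, hη, hφη⟩ := hφbelow
  obtain ⟨v, hv⟩ : ∃ v : ℝ, value T F g U C l φ = v :=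
    ⟨_, (EReal.coe_toReal hvalue_top hvalue_bot).symm⟩
  have hmin : ∀ k : ℕ, ∃ x u, Feasible T F g U C x u ∧
      cost T l φ x u < ((v + 1 / ((k : ℝ) + 1) : ℝ) : EReal) := by
    intro k
    have h1 : value T F g U C l φ < ((v + 1 / ((k : ℝ) + 1) : ℝ) : EReal) := by
      rw [hv]
      exact_mod_cast lt_add_of_pos_right v (by positivity : (0 : ℝ) < 1 / ((k : ℝ) + 1))
    obtain ⟨_, ⟨x, u, hxu, rfl⟩, hlt⟩ := sInf_lt_iff.1 h1
    exact ⟨x, u, hxu, hlt⟩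
  choose xk uk hfeas hcost using hmin
  have hTmem : T ∈ Icc 0 T := right_mem_Icc.2 hT.le
  have h0mem : (0 : ℝ) ∈ Icc 0 T := left_mem_Icc.2 hT.le
  -- A feasible control takes values in `U` almost everywhere on an interval of positive length.
  have hne : U.Nonempty := by
    have : (ae (timeMeasure T)).NeBot := by
      rw [ae_neBot, Ne, Measure.restrict_eq_zero, Real.volume_Icc]
      simpa using hT
    obtain ⟨t, ht⟩ := (hfeas 0).control.2.exists
    exact ⟨_, ht⟩
  obtain ⟨R₀, hR₀⟩ := hC.isBounded.exists_norm_le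
  obtain ⟨R, ψ, hψ, hψ1, hbound⟩ := exists_apriori_bound (C := C) hT hUbdd hUconvex hne hF hg hG R₀
  have hbd := fun k => hbound (xk k) (uk k) (hfeas k)
    ((norm_fst_le _).trans (hR₀ _ (hfeas k).endpoints))
  obtain ⟨x, u, ns, W, w, hns, hxac, huc, hxlim, huw, hW, hdlim, hulim⟩ :=
    exists_limit_pair hT hUbdd hUclosed hUconvex (fun k => (hfeas k).ac)
      (fun k => (hfeas k).control) (fun k => (hbd k).1) hψ hψ1 (fun k => (hbd k).2)
  have hGlim := hG.tendsto _ x _ u (fun k => (hfeas (ns k)).ac.continuousOn hT)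
    (hxac.continuousOn hT) hxlim (fun k => (hfeas (ns k)).control) huc huw
  have hend : Tendsto (fun k => (xk (ns k) 0, xk (ns k) T)) atTop (𝓝 (x 0, x T)) :=
    (hxlim.tendsto_at h0mem).prodMk_nhds (hxlim.tendsto_at hTmem)
  have hfeasible : Feasible T F g U C x u := by
    refine ⟨hxac, huc, ?_, hC.isClosed.mem_of_tendsto hend
      (Eventually.of_forall fun k => (hfeas (ns k)).endpoints)⟩
    filter_upwards [hdlim, hF.usc, ae_all_iff.2 fun k => (hfeas (ns k)).inclusion,
      ae_restrict_mem measurableSet_Icc] with t h1 h2 h3 ht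
    -- The integral terms converge at every `t`, so their tail averages have the same limit, and
    -- only the selections from `F` need the closure lemma.
    refine ⟨deriv x t - integralMap g x u t, ?_, (sub_add_cancel _ _).symm⟩
    refine mem_of_tailWeights_of_upperHemicontinuous h2 (hF.closed t ht _) (hF.convex t ht _)
      (hxlim.tendsto_at ht)
      (q := fun k => deriv (xk (ns k)) t - integralMap g (xk (ns k)) (uk (ns k)) t) (fun k => ?_) hW
      ((h1.sub (hW.tendsto (hGlim t ht))).congr fun N => ?_)
    · obtain ⟨y, hy, hyd⟩ := h3 k
      rw [hyd, add_sub_cancel_right]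
      exact hy
    · rw [← Finset.sum_sub_distrib]
      exact Finset.sum_congr rfl fun k _ => (smul_sub _ _ _).symm
  have hle : value T F g U C l φ ≤ cost T l φ x u := sInf_le ⟨x, u, hfeasible, rfl⟩
  refine ⟨x, u, hfeasible, le_antisymm ?_ hle⟩
  rw [hv]
  -- Since `⊥` absorbs in sums, `ℓ = -∞` at the limit would make the value `-∞`.
  have hl_bot : l (x 0, x T) ≠ ⊥ := by
    intro h
    refine hvalue_bot (le_bot_iff.1 (hle.trans ?_))
    rw [cost, h, EReal.bot_add]
  -- A real `c` below `ℓ` at the limit decouples the two terms: by lower semicontinuity the costs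
  -- eventually force the integrals below `v + ε - c`.
  have hint : ∀ c : ℝ, (c : EReal) < l (x 0, x T) → ∀ ε : ℝ, 0 < ε →
      integralEReal T (fun s => φ s (x s, deriv x s, u s)) ≤ ((v + ε - c : ℝ) : EReal) := by
    intro c hc ε hε
    refine integralEReal_le_of_eventually_le hUclosed hUconvex hφ hφconvex hη hφη
      (xk := fun k => xk (ns k)) (yk := fun k => deriv (xk (ns k))) (uk := fun k => uk (ns k))
      (fun k => ((hfeas (ns k)).ac.continuousOn hT).aemeasurable measurableSet_Icc)
      (fun k => ((hfeas (ns k)).ac.integrableOn_deriv hT).aestronglyMeasurable.aemeasurable)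
      (fun k => (hfeas (ns k)).control) ((hxac.continuousOn hT).aemeasurable measurableSet_Icc)
      (hxac.integrableOn_deriv hT).aestronglyMeasurable.aemeasurable huc
      (fun t ht => hxlim.tendsto_at ht)
      ((ae_all_iff.2 fun k => (hbd (ns k)).2).mono fun t ht => ⟨ψ t, ht⟩) hUbdd hW hdlim hulim ?_
    have hsmall : ∀ᶠ k : ℕ in atTop, 1 / (((ns k : ℕ) : ℝ) + 1) < ε :=
      (tendsto_one_div_add_atTop_nhds_zero_nat.comp hns.tendsto_atTop).eventually_lt_const hε
    filter_upwards [hend.eventually (hl _ _ hc), hsmall] with k h1 h2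
    have h3 := (hcost (ns k)).le
    rw [cost] at h3
    have h4 : (c : EReal) + integralEReal T
        (fun s => φ s (xk (ns k) s, deriv (xk (ns k)) s, uk (ns k) s)) ≤ ((v + ε : ℝ) : EReal) :=
      (add_le_add_left h1.le _).trans (h3.trans (EReal.coe_le_coe_iff.2 (by linarith)))
    rw [EReal.coe_sub, EReal.le_sub_iff_add_le (Or.inl (EReal.coe_ne_bot _))
      (Or.inl (EReal.coe_ne_top _)), add_comm]
    exact h4
  rw [cost]
  generalize integralEReal T (fun s => φ s (x s, deriv x s, u s)) = I at hint
  obtain ⟨c₀, hc₀⟩ := EReal.lt_iff_exists_real_btwn.1 (bot_lt_iff_ne_bot.2 hl_bot)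
  have hI := hint c₀ hc₀.2 1 one_pos
  induction I with
  | bot => simp
  | top => exact absurd hI (not_le.2 (EReal.coe_lt_top _))
  | coe i =>
    rw [← EReal.le_sub_iff_add_le (Or.inl (EReal.coe_ne_bot _)) (Or.inl (EReal.coe_ne_top _)),
      ← EReal.coe_sub]
    by_contra hcon
    obtain ⟨c, hc, hcl⟩ := EReal.lt_iff_exists_real_btwn.1 (not_le.1 hcon)
    have hc' : v - i < c := EReal.coe_lt_coe_iff.1 hc
    -- With `ε` half of the gap `c - (v - i)`, the bound `i ≤ v + ε - c` is contradictory.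
    have h1 := EReal.coe_le_coe_iff.1 (hint c hcl ((c - (v - i)) / 2) (by linarith))
    linarith
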